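/- Let $K$ be a field and let $A=K[a_1,\dots,a_n]$ be a solvable polynomial algebra: the monomials $a^\alpha=a_1^{\alpha_1}\cdots a_n^{\alpha_n}$, $\alpha\in\mathbb N^n$, form a $K$-basis $\mathcal B$ of $A$, and there is a two-sided monomial ordering $\prec$ on $\mathcal B$ such that $a^\alpha a^\beta=\lambda_{\alpha,\beta}a^{\alpha+\beta}+f_{\alpha,\beta}$ with $\lambda_{\alpha,\beta}\in K\setminus\{0\}$ and $\mathrm{LM}(f_{\alpha,\beta})\prec a^{\alpha+\beta}$ whenever $f_{\alpha,\beta}\neq0$. Here a two-sided monomial ordering is a well-ordering of $\mathcal B$ such that $u=\mathrm{LM}(v w v')$, $u\ne 1$, $w\ne u$ imply $w\prec u$, and such that $w\prec w'$ implies $\mathrm{LM}(vwv')\prec\mathrm{LM}(vw'v')$ whenever $vwv'\neq 0$, $vw'v'\ne0$ and $\mathrm{LM}(vw'v')\neq1$ $(u,v,v',w,w'\in\mathcal B)$. Let $m_1,\dots,m_n$ be positive integers, $d(a^\alpha)=\sum_i m_i\alpha_i$, $F_pA=K\text{-span}\{a^\alpha\mid d(a^\alpha)\le p\}$ for $p\in\mathbb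 N$, and assume that $F_pA\,F_qA\subseteq F_{p+q}A$ for all $p,q\in\mathbb N$. All modules are left modules. For a module $M$ with an increasing exhaustive filtration by $K$-subspaces $F_qM$, $q\in\mathbb N$, such that $F_pA\,F_qM\subseteq F_{p+q}M$, put $F_{-1}M=0$, $G(M)=\bigoplus_{q\in\mathbb N} F_qM/F_{q-1}M$ and $\widetilde M=\bigoplus_{q\in\mathbb N}F_qM$; these are graded modules over the associated graded algebra $G(A)$ and over the Rees algebra $\widetilde A$. A homomorphism $\varphi:M\to M'$ is filtered if $\varphi(F_qM)\subseteq F_qM'$ for all $q$, and strict filtered if $\varphi(F_qM)=\varphi(M)\cap F_qM'$ for all $q$; a filtered $\varphi$ induces graded homomorphisms $G(\varphi):G(M)\to G(M')$ and $\widetilde\varphi:\widetilde M\to\widetilde{M'}$. Submodules $N\subseteq M$ carry the filtration $N\cap F_qM$, quotients $M/N$ the filtration $(F_qM+N)/N$. A finite family $(v_i)$ of nonzero elements of $M$ is an F-basis of $M$ if there are $n_i\in\mathbb N$ with $F_qM=\sum_i\big(\sum_{p+n_i\le q}F_pA\big)v_i$ for all $q$; it is a minimal F-basis if moreover no proper subfamily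 is an F-basis. A minimal standard basis of a submodule is a minimal F-basis of it for the induced filtration. A filtered free module is $L=\bigoplus_{i=1}^sAe_i$ with $F_qL=\sum_i\big(\sum_{p+b_i\le q}F_pA\big)e_i$ for some $b_1,\dots,b_s\in\mathbb N$; then $\sigma(e_i)\in G(L)$ and $\widetilde e_i\in\widetilde L$ denote the homogeneous elements of degree $b_i$ represented by $e_i$. Let $L_0=\bigoplus_{i=1}^mAe_i$ be a filtered free module, $N$ a submodule of $L_0$, and $M=L_0/N$ with the induced filtration. A minimal filtered free resolution of $M$ is an exact sequence $$\mathcal L_\bullet:\quad\cdots\to L_i\xrightarrow{\varphi_i}L_{i-1}\to\cdots\to L_1\xrightarrow{\varphi_1}L_0\xrightarrow{\varphi_0}M\to0$$ in which $\varphi_0$ is the canonical epimorphism, the $\varphi_0(e_j)$ form a minimal F-basis of $M$, and for $i\ge1$, $L_i$ is a filtered free module of finite rank, $\varphi_i$ is a strict filtered homomorphism, and the images under $\varphi_i$ of the basis elements of $L_i$ form (as a family indexed by that basis) a minimal standard basis of $\ker\varphi_{i-1}$. A minimal graded free resolution of a graded module $Y$ over a graded ring is an exact sequence $\cdots\xrightarrow{f_2}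 X_1\xrightarrow{f_1}X_0\xrightarrow{f_0}Y\to0$ of graded homomorphisms (of degree $0$), in which each $X_i$ is free with a finite homogeneous basis $E_i$, such that $f_0(E_0)$ is a minimal homogeneous generating set of $Y$, and $f_i(E_i)$ is a minimal homogeneous generating set of $\ker f_{i-1}$ for $i\ge1$ (again as indexed families: no proper subfamily generates). **Theorem.** Let $\mathcal L_\bullet$ be a minimal filtered free resolution of $M=L_0/N$. (i) The induced sequence $G(\mathcal L_\bullet)$, with terms $G(L_i)$, $G(M)$ and maps $G(\varphi_i)$, is a minimal graded free resolution of the graded $G(A)$-module $G(M)$, with homogeneous bases the families of the $\sigma(e)$, $e$ running over the basis of $L_i$. (ii) The induced sequence $\widetilde{\mathcal L}_\bullet$, with terms $\widetilde L_i$, $\widetilde M$ and maps $\widetilde\varphi_i$, is a minimal graded free resolution of the graded $\widetilde A$-module $\widetilde M$, with homogeneous bases the families of the $\widetilde e$, $e$ running over the basis of $L_i$. (iii) If $\mathcal L'_\bullet:\ \cdots\to L'_2\xrightarrow{\varphi_2'}L'_1\xrightarrow{\varphi'_1}L_0\xrightarrow{\varphi_0}M\to0$ is another minimal filtered free resolution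 of $M$, then there are $A$-module isomorphisms $\chi_i:L_i\to L_i'$, $i\ge0$, with $L_0'=L_0$ and $\chi_0=\mathrm{id}_{L_0}$, each of which is strict filtered, such that $\chi_{i-1}\varphi_i=\varphi'_i\chi_i$ for all $i\ge1$. -/

import Mathlib

open scoped DirectSum

namespace SolvRes

universe u v w

/-! ### Minimal graded free resolutions

Graded rings and graded modules are external direct sums of their homogeneous parts. -/

section GradedResolution

/-- `x` lies in the homogeneous part of degree `q`. -/
def IsHomogeneousOfDegree {X : ℕ → Type*} [∀ q, AddCommGroup (X q)] (q : ℕ) (x : ⨁ q, X q) :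
    Prop :=
  x ∈ Set.range (DirectSum.of X q)

variable {𝒜 : ℕ → Type*} [∀ p, AddCommGroup (𝒜 p)] [DirectSum.GRing 𝒜]

variable (𝒜) in
/-- Linear maps between direct sums of graded families, over the graded ring `⨁ p, 𝒜 p`. -/
abbrev GMap (X Y : ℕ → Type*) [∀ q, AddCommGroup (X q)] [∀ q, AddCommGroup (Y q)]
    [DirectSum.Gmodule 𝒜 X] [DirectSum.Gmodule 𝒜 Y] :=
  (⨁ q, X q) →ₗ[⨁ p, 𝒜 p] (⨁ q, Y q)

/-- `f` is a graded homomorphism (of degree 0). -/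
def IsGradedHom {X Y : ℕ → Type*} [∀ q, AddCommGroup (X q)] [∀ q, AddCommGroup (Y q)]
    [DirectSum.Gmodule 𝒜 X] [DirectSum.Gmodule 𝒜 Y]
    (f : GMap 𝒜 X Y) : Prop :=
  ∀ q x, IsHomogeneousOfDegree q x → IsHomogeneousOfDegree q (f x)

variable (𝒜) in
/-- `v` is a minimal homogeneous generating set of the submodule `N`: it consists of homogeneous
elements, it generates `N`, and no proper subfamily generates `N`. -/
def IsMinimalHomogeneousGenerating {X : ℕ → Type*} [∀ q, AddCommGroup (X q)]
    [DirectSum.Gmodule 𝒜 X] (N : Submodule (⨁ p, 𝒜 p) (⨁ q, X q)) {ι : Type*}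
    (v : ι → ⨁ q, X q) : Prop :=
  (∀ i, ∃ q, IsHomogeneousOfDegree q (v i)) ∧
    Submodule.span (⨁ p, 𝒜 p) (Set.range v) = N ∧
    ∀ T : Set ι, T ≠ Set.univ → Submodule.span (⨁ p, 𝒜 p) (v '' T) ≠ N

/-- The sequence `⋯ → X_2 → X_1 → X_0 → Y → 0`, with maps `f i : X_{i+1} → X_i` and
`ε : X_0 → Y`, is a minimal graded free resolution of the graded module `Y`, where `E i` is the
finite homogeneous basis of `X_i`. -/
structure IsMinimalGradedFreeResolution {X : ℕ → ℕ → Type*} [∀ i q, AddCommGroup (X i q)]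
    [∀ i, DirectSum.Gmodule 𝒜 (X i)] {Y : ℕ → Type*} [∀ q, AddCommGroup (Y q)]
    [DirectSum.Gmodule 𝒜 Y] {ι : ℕ → Type*} (E : ∀ i, ι i → ⨁ q, X i q)
    (f : ∀ i, GMap 𝒜 (X (i + 1)) (X i)) (ε : GMap 𝒜 (X 0) Y) : Prop where
  finite : ∀ i, Finite (ι i)
  homogeneous : ∀ i j, ∃ q, IsHomogeneousOfDegree q (E i j)
  linearIndependent : ∀ i, LinearIndependent (⨁ p, 𝒜 p) (E i)
  span_eq_top : ∀ i, Submodule.span (⨁ p, 𝒜 p) (Set.range (E i)) = ⊤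
  graded : ∀ i, IsGradedHom (f i)
  graded_aug : IsGradedHom ε
  surjective : Function.Surjective ε
  exact_zero : Function.Exact (f 0) ε
  exact_succ : ∀ i, Function.Exact (f (i + 1)) (f i)
  minimal_aug : IsMinimalHomogeneousGenerating 𝒜 ⊤ (fun j => ε (E 0 j))
  minimal_zero : IsMinimalHomogeneousGenerating 𝒜 (LinearMap.ker ε) (fun j => f 0 (E 1 j))
  minimal_succ : ∀ i, IsMinimalHomogeneousGenerating 𝒜 (LinearMap.ker (f i))
    (fun j => f (i + 1) (E (i + 2) j))

end GradedResolution

/-! ### Filtrations indexed by `ℕ`, by subspaces -/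

section Filtrations

variable {K : Type u} [Field K] {A : Type v} [Ring A] [Algebra K A]

/-- `FA` is an (exhaustive, increasing) `ℕ`-filtration of the `K`-algebra `A`. -/
class IsAlgFiltration (FA : ℕ → Submodule K A) : Prop where
  mono : Monotone FA
  one_mem : (1 : A) ∈ FA 0
  mul_mem : ∀ {p q : ℕ} {x y : A}, x ∈ FA p → y ∈ FA q → x * y ∈ FA (p + q)
  exhaustive : ∀ x : A, ∃ p, x ∈ FA p

/-- `FM` is an (exhaustive, increasing) `ℕ`-filtration of the left `A`-module `M`, compatible
with the filtration `FA` of `A`. -/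
class IsModFiltration (FA : ℕ → Submodule K A) {M : Type w} [AddCommGroup M] [Module K M]
    [Module A M] (FM : ℕ → Submodule K M) : Prop where
  mono : Monotone FM
  smul_mem : ∀ {p q : ℕ} {a : A} {x : M}, a ∈ FA p → x ∈ FM q → a • x ∈ FM (p + q)
  exhaustive : ∀ x : M, ∃ q, x ∈ FM q

instance (FA : ℕ → Submodule K A) [h : IsAlgFiltration FA] : IsModFiltration FA FA where
  mono := h.mono
  smul_mem := h.mul_mem
  exhaustive := h.exhaustive

/-- The filtration step just below: `F_{q-1}`, with `F_{-1} = 0`. -/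
def lower {M : Type w} [AddCommGroup M] [Module K M] (FM : ℕ → Submodule K M) :
    ℕ → Submodule K M
  | 0 => ⊥
  | q + 1 => FM q

/-- The homogeneous part `G(M)_q = F_q M / F_{q-1} M` of the associated graded module. -/
def Gr {M : Type w} [AddCommGroup M] [Module K M] (FM : ℕ → Submodule K M) (q : ℕ) : Type w :=
  (FM q) ⧸ (lower FM q).comap (FM q).subtype

instance {M : Type w} [AddCommGroup M] [Module K M] (FM : ℕ → Submodule K M) (q : ℕ) :
    AddCommGroup (Gr FM q) :=
  inferInstanceAs (AddCommGroup ((FM q) ⧸ (lower FM q).comap (FM q).subtype))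

instance {M : Type w} [AddCommGroup M] [Module K M] (FM : ℕ → Submodule K M) (q : ℕ) :
    Module K (Gr FM q) :=
  inferInstanceAs (Module K ((FM q) ⧸ (lower FM q).comap (FM q).subtype))

/-- The class in `G(M)_q` of an element of `F_q M`. -/
def Gr.mk {M : Type w} [AddCommGroup M] [Module K M] (FM : ℕ → Submodule K M) (q : ℕ) :
    FM q →ₗ[K] Gr FM q :=
  Submodule.mkQ ((lower FM q).comap (FM q).subtype)

lemma Gr.mk_surjective {M : Type w} [AddCommGroup M] [Module K M] {FM : ℕ → Submodule K M}
    {q : ℕ} : Function.Surjective (Gr.mk FM q) :=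
  Submodule.mkQ_surjective _

lemma Gr.mk_eq_zero {M : Type w} [AddCommGroup M] [Module K M] {FM : ℕ → Submodule K M} {q : ℕ}
    {x : FM q} : Gr.mk FM q x = 0 ↔ (x : M) ∈ lower FM q :=
  (Submodule.Quotient.mk_eq_zero ((lower FM q).comap (FM q).subtype))

lemma Gr.sigma_ext {M : Type w} [AddCommGroup M] [Module K M] {FM : ℕ → Submodule K M} {p q : ℕ}
    (h : p = q) {x : FM p} {y : FM q} (hxy : (x : M) = y) :
    (⟨p, Gr.mk FM p x⟩ : GradedMonoid (Gr FM)) = ⟨q, Gr.mk FM q y⟩ := by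
  subst h
  rw [Subtype.ext hxy]

end Filtrations

/-! ### Associated graded algebra and module -/

section Graded

variable {K : Type u} [Field K] {A : Type v} [Ring A] [Algebra K A]
variable (FA : ℕ → Submodule K A)
variable {M : Type w} [AddCommGroup M] [Module K M] [Module A M]
variable (FM : ℕ → Submodule K M)

lemma smul_mem_lower_left [IsModFiltration FA FM] {p q : ℕ} {a : A} {x : M}
    (ha : a ∈ lower FA p) (hx : x ∈ FM q) : a • x ∈ lower FM (p + q) := by
  cases p with
  | zero =>
    have : a = 0 := by simpa [lower] using ha
    simp [this]
  | succ p =>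
    have h := IsModFiltration.smul_mem (FA := FA) (FM := FM) (p := p) ha hx
    rw [show p + 1 + q = (p + q) + 1 by omega]
    exact h

lemma smul_mem_lower_right [IsModFiltration FA FM] {p q : ℕ} {a : A} {x : M}
    (ha : a ∈ FA p) (hx : x ∈ lower FM q) : a • x ∈ lower FM (p + q) := by
  cases q with
  | zero =>
    have : x = 0 := by simpa [lower] using hx
    simp [this]
  | succ q => exact IsModFiltration.smul_mem (FA := FA) (FM := FM) ha hx

variable [IsScalarTower K A M]

/-- The action `F_p A × F_q M → F_{p+q} M`, as a `K`-bilinear map. -/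
def filSMul [IsModFiltration FA FM] (p q : ℕ) : FA p →ₗ[K] FM q →ₗ[K] FM (p + q) :=
  LinearMap.mk₂ K (fun a x => ⟨(a : A) • (x : M), IsModFiltration.smul_mem a.2 x.2⟩)
    (fun a b x => Subtype.ext (add_smul (a : A) (b : A) (x : M)))
    (fun c a x => Subtype.ext (smul_assoc c (a : A) (x : M)))
    (fun a x y => Subtype.ext (smul_add (a : A) (x : M) (y : M)))
    (fun c a x => Subtype.ext (by
      have : (a : A) • c • (x : M) = c • (a : A) • (x : M) := smul_comm _ _ _
      exact this))

/-- The induced action `G(A)_p × G(M)_q → G(M)_{p+q}`,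
`(a + F_{p-1} A) (x + F_{q-1} M) = a x + F_{p+q-1} M`. -/
def grSMul [IsModFiltration FA FM] (p q : ℕ) : Gr FA p →ₗ[K] Gr FM q →ₗ[K] Gr FM (p + q) :=
  Submodule.liftQ ((lower FA p).comap (FA p).subtype)
    (LinearMap.flip (Submodule.liftQ ((lower FM q).comap (FM q).subtype) (LinearMap.flip
      ((filSMul FA FM p q).compr₂ (Gr.mk FM (p + q))))
      (by
        intro x hx
        refine LinearMap.ext fun a => Gr.mk_eq_zero.2 ?_
        exact smul_mem_lower_right FA FM a.2 hx)))
    (by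
      intro a ha
      refine LinearMap.ext fun x => ?_
      obtain ⟨x, rfl⟩ := Gr.mk_surjective x
      exact Gr.mk_eq_zero.2 (smul_mem_lower_left FA FM ha x.2))

lemma grSMul_mk [IsModFiltration FA FM] {p q : ℕ} (a : FA p) (x : FM q) :
    grSMul FA FM p q (Gr.mk FA p a) (Gr.mk FM q x) =
      Gr.mk FM (p + q) ⟨(a : A) • (x : M), IsModFiltration.smul_mem a.2 x.2⟩ := rfl

/-- The multiplication `G(A)_p × G(A)_q → G(A)_{p+q}`,
`(a + F_{p-1} A) (b + F_{q-1} A) = a b + F_{p+q-1} A`. -/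
instance grMul [IsAlgFiltration FA] : GradedMonoid.GMul (Gr FA) where
  mul {p q} a b := grSMul FA FA p q a b

/-- The unit of `G(A)`, the class of `1` in `G(A)_0`. -/
instance grOne [IsAlgFiltration FA] : GradedMonoid.GOne (Gr FA) where
  one := Gr.mk FA 0 ⟨1, IsAlgFiltration.one_mem⟩

/-- The family `G(A)_p` is a graded ring. -/
instance grRing [IsAlgFiltration FA] : DirectSum.GRing (Gr FA) where
  toGMul := grMul FA
  toGOne := grOne FA
  mul_zero {p q} a := map_zero (grSMul FA FA p q a)
  zero_mul {p q} b := LinearMap.map_zero₂ (grSMul FA FA p q) b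
  mul_add {p q} a b c := map_add (grSMul FA FA p q a) b c
  add_mul {p q} a b c := LinearMap.map_add₂ (grSMul FA FA p q) a b c
  one_mul := by
    rintro ⟨p, a⟩
    obtain ⟨a, rfl⟩ := Gr.mk_surjective a
    exact Gr.sigma_ext (zero_add p) (one_mul (a : A))
  mul_one := by
    rintro ⟨p, a⟩
    obtain ⟨a, rfl⟩ := Gr.mk_surjective a
    exact Gr.sigma_ext (add_zero p) (mul_one (a : A))
  mul_assoc := by
    rintro ⟨p, a⟩ ⟨q, b⟩ ⟨r, c⟩
    obtain ⟨a, rfl⟩ := Gr.mk_surjective a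
    obtain ⟨b, rfl⟩ := Gr.mk_surjective b
    obtain ⟨c, rfl⟩ := Gr.mk_surjective c
    exact Gr.sigma_ext (add_assoc p q r) (mul_assoc (a : A) b c)
  natCast n := n • Gr.mk FA 0 ⟨1, IsAlgFiltration.one_mem⟩
  natCast_zero := zero_smul _ _
  natCast_succ n := succ_nsmul _ n
  intCast n := n • Gr.mk FA 0 ⟨1, IsAlgFiltration.one_mem⟩
  intCast_ofNat n := natCast_zsmul _ n
  intCast_negSucc_ofNat n := negSucc_zsmul _ n

/-- The family `G(M)_q` is a graded module over the graded ring `G(A)_p`. -/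
instance grModule [IsAlgFiltration FA] [IsModFiltration FA FM] :
    DirectSum.Gmodule (Gr FA) (Gr FM) where
  smul {p q} a x := grSMul FA FM p q a x
  one_smul := by
    rintro ⟨q, x⟩
    obtain ⟨x, rfl⟩ := Gr.mk_surjective x
    exact Gr.sigma_ext (zero_add q) (one_smul A (x : M))
  mul_smul := by
    rintro ⟨p, a⟩ ⟨q, b⟩ ⟨r, x⟩
    obtain ⟨a, rfl⟩ := Gr.mk_surjective a
    obtain ⟨b, rfl⟩ := Gr.mk_surjective b
    obtain ⟨x, rfl⟩ := Gr.mk_surjective x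
    exact Gr.sigma_ext (add_assoc p q r) (mul_smul (a : A) (b : A) (x : M))
  smul_add {p q} a x y := map_add (grSMul FA FM p q a) x y
  smul_zero {p q} a := map_zero (grSMul FA FM p q a)
  add_smul {p q} a b x := LinearMap.map_add₂ (grSMul FA FM p q) a b x
  zero_smul {p q} x := LinearMap.map_zero₂ (grSMul FA FM p q) x

end Graded

/-! ### Rees algebra and Rees module

The Rees algebra is `⨁ p, F_p A`, the Rees module is `⨁ q, F_q M`, with the multiplication and the
action coming from those of `A` on `A` and on `M`. -/

section Rees

variable {K : Type u} [Field K] {A : Type v} [Ring A] [Algebra K A]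
variable (FA : ℕ → Submodule K A)
variable {M : Type w} [AddCommGroup M] [Module K M] [Module A M]
variable (FM : ℕ → Submodule K M)

instance reesRing [h : IsAlgFiltration FA] : SetLike.GradedMonoid FA where
  one_mem := h.one_mem
  mul_mem _ _ _ _ hx hy := h.mul_mem hx hy

instance reesModule [h : IsModFiltration FA FM] : SetLike.GradedSMul FA FM where
  smul_mem _ _ _ _ ha hx := h.smul_mem ha hx

/-- The homogeneous part `F_q M` of degree `q` of the Rees module. -/
abbrev Rees (q : ℕ) : Type w := FM q

end Rees

/-! ### Filtered homomorphisms and the maps they induce -/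

section Maps

variable {K : Type u} [Field K] {A : Type v} [Ring A]
variable {M M' : Type*} [AddCommGroup M] [Module K M] [Module A M]
variable [AddCommGroup M'] [Module K M'] [Module A M']
variable (FM : ℕ → Submodule K M) (FM' : ℕ → Submodule K M')

/-- `φ` is a filtered homomorphism: `φ (F_q M) ⊆ F_q M'` for all `q`. -/
def IsFiltered (φ : M →ₗ[A] M') : Prop :=
  ∀ q, ∀ x ∈ FM q, φ x ∈ FM' q

/-- `φ` is a strict filtered homomorphism: `φ (F_q M) = φ (M) ∩ F_q M'` for all `q`. -/
def IsStrictFiltered (φ : M →ₗ[A] M') : Prop :=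
  ∀ q, φ '' (FM q : Set M) = Set.range φ ∩ (FM' q : Set M')

variable {FM FM'}

lemma IsStrictFiltered.isFiltered {φ : M →ₗ[A] M'} (h : IsStrictFiltered FM FM' φ) :
    IsFiltered FM FM' φ := fun q _ hx =>
  ((h q).subset (Set.mem_image_of_mem φ hx)).2

variable [Algebra K A] [IsScalarTower K A M] [IsScalarTower K A M'] (FA : ℕ → Submodule K A)

/-- The restriction `F_q M → F_q M'` of a filtered homomorphism. -/
def filMap (φ : M →ₗ[A] M') (h : IsFiltered FM FM' φ) (q : ℕ) : FM q →ₗ[K] FM' q :=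
  (φ.restrictScalars K).restrict (h q)

/-- The homomorphism `G(M)_q → G(M')_q`, `x + F_{q-1} M ↦ φ x + F_{q-1} M'`. -/
def grMapComponent (φ : M →ₗ[A] M') (h : IsFiltered FM FM' φ) (q : ℕ) : Gr FM q →ₗ[K] Gr FM' q :=
  Submodule.mapQ ((lower FM q).comap (FM q).subtype) ((lower FM' q).comap (FM' q).subtype)
    (filMap φ h q) (by
    intro x hx
    cases q with
    | zero =>
      have h0 : (x : M) = 0 := by simpa [lower] using hx
      have : φ (x : M) = 0 := by rw [h0, map_zero]
      exact (Submodule.mem_bot K).2 this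
    | succ q => exact h q x hx)

/-- The `G(A)`-linear map `G(φ) : G(M) → G(M')` induced by a filtered homomorphism `φ`. -/
def grMap [IsAlgFiltration FA] [IsModFiltration FA FM] [IsModFiltration FA FM']
    (φ : M →ₗ[A] M') (h : IsFiltered FM FM' φ) :
    (⨁ q, Gr FM q) →ₗ[⨁ p, Gr FA p] (⨁ q, Gr FM' q) where
  toFun := DirectSum.map fun q => (grMapComponent φ h q).toAddMonoidHom
  map_add' := map_add _
  map_smul' := by
    intro a x
    induction a using DirectSum.induction_on with
    | zero => simp
    | add a b ha hb => rw [add_smul, map_add, ha, hb]; simp [add_smul]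
    | of p a =>
      induction x using DirectSum.induction_on with
      | zero => simp
      | add x y hx hy => rw [smul_add, map_add, hx, hy, map_add, smul_add]
      | of q x =>
        obtain ⟨a, rfl⟩ := Gr.mk_surjective a
        obtain ⟨x, rfl⟩ := Gr.mk_surjective x
        rw [DirectSum.Gmodule.of_smul_of, DirectSum.map_of, DirectSum.map_of, RingHom.id_apply,
          DirectSum.Gmodule.of_smul_of]
        refine congrArg (DirectSum.of (Gr FM') (p + q)) ?_
        refine congrArg (Gr.mk FM' (p + q)) (Subtype.ext ?_)
        exact map_smul φ (a : A) (x : M)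

/-- The linear map of Rees modules induced by a filtered homomorphism `φ`. -/
def reesMap [IsAlgFiltration FA] [IsModFiltration FA FM] [IsModFiltration FA FM']
    (φ : M →ₗ[A] M') (h : IsFiltered FM FM' φ) :
    (⨁ q, Rees FM q) →ₗ[⨁ p, Rees FA p] (⨁ q, Rees FM' q) where
  toFun := DirectSum.map fun q => (filMap φ h q).toAddMonoidHom
  map_add' := map_add _
  map_smul' := by
    intro a x
    induction a using DirectSum.induction_on with
    | zero => simp
    | add a b ha hb => rw [add_smul, map_add, ha, hb]; simp [add_smul]
    | of p a =>
      induction x using DirectSum.induction_on with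
      | zero => simp
      | add x y hx hy => rw [smul_add, map_add, hx, hy, map_add, smul_add]
      | of q x =>
        rw [DirectSum.Gmodule.of_smul_of, DirectSum.map_of, DirectSum.map_of, RingHom.id_apply,
          DirectSum.Gmodule.of_smul_of]
        refine congrArg (DirectSum.of (Rees FM') (p + q)) (Subtype.ext ?_)
        exact map_smul φ (a : A) (x : M)

end Maps

/-! ### Good filtrations, F-bases and standard bases

Finite sets of elements are given as families indexed by a finite type, so that listed elements
count with their index. -/

section Bases

variable {K : Type u} [Field K] {A : Type v} [Ring A] [Algebra K A]
variable (FA : ℕ → Submodule K A)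
variable {M : Type w} [AddCommGroup M] [Module K M] [Module A M]

/-- `∑ i, (∑_{p + n i ≤ q} F_p A) v i`. -/
def goodFil {ι : Type*} (v : ι → M) (n : ι → ℕ) (q : ℕ) : Submodule K M :=
  Submodule.span K {x | ∃ (i : ι) (p : ℕ) (a : A), p + n i ≤ q ∧ a ∈ FA p ∧ x = a • v i}

/-- The finite family `v` of nonzero elements is an F-basis of `M` with respect to `FM`. -/
def IsFBasis (FM : ℕ → Submodule K M) {ι : Type*} (v : ι → M) : Prop :=
  (∀ i, v i ≠ 0) ∧ ∃ n : ι → ℕ, ∀ q, FM q = goodFil FA v n q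

/-- `v` is an F-basis and no proper subfamily of `v` is one. -/
def IsMinimalFBasis (FM : ℕ → Submodule K M) {ι : Type*} (v : ι → M) : Prop :=
  IsFBasis FA FM v ∧ ∀ T : Set ι, T ≠ Set.univ → ¬ IsFBasis FA FM (fun i : T => v i)

variable [IsScalarTower K A M]

/-- The filtration `F_q N = N ∩ F_q M` induced on a submodule. -/
def inducedFil (FM : ℕ → Submodule K M) (N : Submodule A M) (q : ℕ) : Submodule K N :=
  (FM q).comap (N.subtype.restrictScalars K)

/-- The filtration `F_q (M / N) = (F_q M + N) / N` induced on a quotient. -/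
def quotFil (FM : ℕ → Submodule K M) (N : Submodule A M) (q : ℕ) : Submodule K (M ⧸ N) :=
  (FM q).map (N.mkQ.restrictScalars K)

/-- `v` is a minimal standard basis of the submodule `N` of `M`: a minimal F-basis of `N` with
respect to the filtration induced by `FM`. -/
def IsMinimalStandardBasis (FM : ℕ → Submodule K M) (N : Submodule A M) {ι : Type*}
    (v : ι → M) : Prop :=
  ∃ h : ∀ i, v i ∈ N, IsMinimalFBasis FA (inducedFil FM N) (fun i => (⟨v i, h i⟩ : N))

instance (FM : ℕ → Submodule K M) [IsModFiltration FA FM] (N : Submodule A M) :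
    IsModFiltration FA (quotFil FM N) where
  mono p q h := Submodule.map_mono (IsModFiltration.mono FA h)
  smul_mem := by
    rintro p q a _ ha ⟨x, hx, rfl⟩
    exact ⟨a • x, IsModFiltration.smul_mem ha hx, map_smul N.mkQ a x⟩
  exhaustive x := by
    obtain ⟨x, rfl⟩ := N.mkQ_surjective x
    obtain ⟨q, hq⟩ := IsModFiltration.exhaustive FA (FM := FM) x
    exact ⟨q, x, hq, rfl⟩

end Bases

/-! ### Filtered free modules -/

/-- The data of a filtered free module `⨁ A e_i` of finite rank: the rank, and the arbitrarily
chosen filtered degrees of the basis elements. -/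
structure FilteredFree where
  /-- the number of basis elements -/
  rank : ℕ
  /-- the filtered degree of the `i`-th basis element -/
  deg : Fin rank → ℕ

namespace FilteredFree

variable {K : Type u} [Field K] {A : Type v} [Ring A] [Algebra K A]

/-- The free left `A`-module `⨁ A e_i`. -/
abbrev Carrier (A : Type v) (L : FilteredFree) : Type v := Fin L.rank → A

/-- The basis element `e_i`. -/
def e (A : Type v) [Ring A] (L : FilteredFree) (i : Fin L.rank) : L.Carrier A := Pi.single i 1

/-- The filtration `F_q L = ∑ i, (∑_{p + deg i ≤ q} F_p A) e_i`. -/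
def fil (FA : ℕ → Submodule K A) (L : FilteredFree) : ℕ → Submodule K (L.Carrier A) :=
  goodFil FA (L.e A) L.deg

lemma e_mem_fil (FA : ℕ → Submodule K A) [IsAlgFiltration FA] (L : FilteredFree)
    (i : Fin L.rank) : L.e A i ∈ L.fil FA (L.deg i) :=
  Submodule.subset_span ⟨i, 0, 1, by simp, IsAlgFiltration.one_mem, (one_smul A _).symm⟩

lemma fil_mono (FA : ℕ → Submodule K A) (L : FilteredFree) : Monotone (L.fil FA) := by
  intro q r h
  apply Submodule.span_mono
  rintro _ ⟨i, p, a, hp, ha, rfl⟩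
  exact ⟨i, p, a, hp.trans h, ha, rfl⟩

instance (FA : ℕ → Submodule K A) [IsAlgFiltration FA] (L : FilteredFree) :
    IsModFiltration FA (L.fil FA) where
  mono := L.fil_mono FA
  smul_mem := by
    intro p q a x ha hx
    induction hx using Submodule.span_induction with
    | mem x hx =>
      obtain ⟨i, r, b, hr, hb, rfl⟩ := hx
      exact Submodule.subset_span
        ⟨i, p + r, a * b, by omega, IsAlgFiltration.mul_mem ha hb, (mul_smul _ _ _).symm⟩
    | zero => rw [smul_zero]; exact zero_mem _
    | add x y _ _ hx hy => rw [smul_add]; exact add_mem hx hy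
    | smul c x _ hx => rw [smul_comm]; exact Submodule.smul_mem _ c hx
  exhaustive x := by
    have hx : x = ∑ i, x i • L.e A i := by
      simpa [e, ← Pi.single_smul] using (Finset.univ_sum_single x).symm
    choose p hp using fun i => IsAlgFiltration.exhaustive (FA := FA) (x i)
    refine ⟨∑ i, (p i + L.deg i), ?_⟩
    rw [hx]
    refine Submodule.sum_mem _ fun i _ => Submodule.subset_span ⟨i, p i, x i, ?_, hp i, rfl⟩
    exact Finset.single_le_sum (f := fun i => p i + L.deg i) (fun _ _ => Nat.zero_le _)
      (Finset.mem_univ i)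

/-- The homogeneous element `σ(e_i)` of degree `deg i` of `G(L)`. -/
def sigmaE (FA : ℕ → Submodule K A) [IsAlgFiltration FA] (L : FilteredFree) (i : Fin L.rank) :
    ⨁ q, Gr (L.fil FA) q :=
  DirectSum.of (Gr (L.fil FA)) (L.deg i) (Gr.mk _ _ ⟨L.e A i, L.e_mem_fil FA i⟩)

/-- The homogeneous element of degree `deg i` of the Rees module of `L` represented by `e_i`. -/
def tildeE (FA : ℕ → Submodule K A) [IsAlgFiltration FA] (L : FilteredFree) (i : Fin L.rank) :
    ⨁ q, Rees (L.fil FA) q :=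
  DirectSum.of (Rees (L.fil FA)) (L.deg i) ⟨L.e A i, L.e_mem_fil FA i⟩

end FilteredFree

/-! ### Minimal filtered free resolutions -/

/-- The sequence `L₀, L 0, L 1, …`. -/
def terms (L₀ : FilteredFree) (L : ℕ → FilteredFree) : ℕ → FilteredFree
  | 0 => L₀
  | i + 1 => L i

section Resolution

variable {K : Type u} [Field K] {A : Type v} [Ring A] [Algebra K A]

/-- A minimal filtered free resolution
`⋯ → L_2 → L_1 → L_0 → L_0 / N → 0` of the quotient `L_0 / N` of a filtered free module `L_0`. The
last map is the canonical epimorphism `N.mkQ`; `d i` is the map `L_{i+1} → L_i`. -/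
structure MinimalFilteredFreeResolution (FA : ℕ → Submodule K A) (L₀ : FilteredFree)
    (N : Submodule A (L₀.Carrier A)) where
  /-- the filtered free modules `L_1, L_2, …` -/
  tail : ℕ → FilteredFree
  /-- the maps `L_{i+1} → L_i` -/
  d : ∀ i, (terms L₀ tail (i + 1)).Carrier A →ₗ[A] (terms L₀ tail i).Carrier A
  strict : ∀ i, IsStrictFiltered ((terms L₀ tail (i + 1)).fil FA) ((terms L₀ tail i).fil FA) (d i)
  exact_zero : Function.Exact (d 0) N.mkQ
  exact_succ : ∀ i, Function.Exact (d (i + 1)) (d i)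
  minimal_aug : IsMinimalFBasis FA (quotFil (L₀.fil FA) N) (fun j => N.mkQ (L₀.e A j))
  minimal_zero : IsMinimalStandardBasis FA (L₀.fil FA) (LinearMap.ker N.mkQ)
    (fun j => d 0 ((tail 0).e A j))
  minimal_succ : ∀ i, IsMinimalStandardBasis FA ((terms L₀ tail (i + 1)).fil FA)
    (LinearMap.ker (d i)) (fun j => d (i + 1) ((tail (i + 1)).e A j))

/-- The `i`-th free module `L_i` of the resolution. -/
abbrev MinimalFilteredFreeResolution.L {FA : ℕ → Submodule K A} {L₀ : FilteredFree}
    {N : Submodule A (L₀.Carrier A)} (R : MinimalFilteredFreeResolution FA L₀ N) (i : ℕ) :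
    FilteredFree :=
  terms L₀ R.tail i

lemma isFiltered_mkQ (FA : ℕ → Submodule K A) (L₀ : FilteredFree)
    (N : Submodule A (L₀.Carrier A)) : IsFiltered (L₀.fil FA) (quotFil (L₀.fil FA) N) N.mkQ :=
  fun _ x hx => ⟨x, hx, rfl⟩

end Resolution

/-! ### `ℕ`-filtered solvable polynomial algebras -/

section Solvable

variable {K : Type u} [Field K] {A : Type v} [Ring A] [Algebra K A] {n : ℕ}

/-- `γ` is the exponent of the leading monomial of `f` in the basis `B` for the ordering `lt`. In
particular `f ≠ 0`. -/
def IsLeadingMonomial (B : Module.Basis (Fin n → ℕ) K A) (lt : (Fin n → ℕ) → (Fin n → ℕ) → Prop)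
    (f : A) (γ : Fin n → ℕ) : Prop :=
  B.repr f γ ≠ 0 ∧ ∀ δ, B.repr f δ ≠ 0 → δ ≠ γ → lt δ γ

/-- `lt` (a strict ordering of exponents) is a two-sided monomial ordering on the basis `B` of
monomials of `A`. -/
structure IsMonomialOrdering (B : Module.Basis (Fin n → ℕ) K A)
    (lt : (Fin n → ℕ) → (Fin n → ℕ) → Prop) : Prop where
  wellOrder : IsWellOrder (Fin n → ℕ) lt
  lt_of_factor : ∀ α β η γ, γ ≠ 0 → β ≠ γ → IsLeadingMonomial B lt (B α * B β * B η) γ → lt β γ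
  mul_lt_mul : ∀ α β γ η μ ν, lt α β → IsLeadingMonomial B lt (B γ * B α * B η) μ →
    IsLeadingMonomial B lt (B γ * B β * B η) ν → ν ≠ 0 → lt μ ν

variable (K A) in
/-- The structure of a solvable polynomial algebra `A = K[a_1, …, a_n]`: generators, whose
monomials form a PBW basis, with a monomial ordering for which
`a^α a^β = c a^(α+β) + f`, with `c ≠ 0` and the leading monomial of `f` smaller than `a^(α+β)`
unless `f = 0`. -/
structure SolvablePolynomialAlgebra where
  /-- the number of generators -/
  n : ℕ
  /-- the generators -/
  gen : Fin n → A
  /-- the PBW basis -/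
  basis : Module.Basis (Fin n → ℕ) K A
  basis_eq : ∀ α, basis α = (List.ofFn fun i => gen i ^ α i).prod
  /-- the monomial ordering -/
  lt : (Fin n → ℕ) → (Fin n → ℕ) → Prop
  isMonomialOrdering : IsMonomialOrdering basis lt
  solvable : ∀ α β, ∃ (c : K) (f : A), c ≠ 0 ∧ basis α * basis β = c • basis (α + β) + f ∧
    ∀ γ, IsLeadingMonomial basis lt f γ → lt γ (α + β)

variable (K A) in
/-- The structure of an `ℕ`-filtered solvable polynomial algebra with respect to the
positive-degree function `d(a^α) = ∑ i, m i * α i`: the subspaces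
`F_p A = span {a^α | d(a^α) ≤ p}` satisfy `F_p A F_q A ⊆ F_{p+q} A`. -/
structure FilteredSolvablePolynomialAlgebra extends SolvablePolynomialAlgebra K A where
  /-- the degrees of the generators -/
  m : Fin n → ℕ
  m_pos : ∀ i, 0 < m i
  mul_mem : ∀ p q x y, x ∈ Submodule.span K (basis '' {α | ∑ i, m i * α i ≤ p}) →
    y ∈ Submodule.span K (basis '' {α | ∑ i, m i * α i ≤ q}) →
    x * y ∈ Submodule.span K (basis '' {α | ∑ i, m i * α i ≤ p + q})

/-- The filtration `F_p A = span {a^α | d(a^α) ≤ p}`. -/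
def FilteredSolvablePolynomialAlgebra.F (S : FilteredSolvablePolynomialAlgebra K A) (p : ℕ) :
    Submodule K A :=
  Submodule.span K (S.basis '' {α | ∑ i, S.m i * α i ≤ p})

instance (S : FilteredSolvablePolynomialAlgebra K A) : IsAlgFiltration S.F where
  mono p q h := Submodule.span_mono (Set.image_mono fun _ hα => le_trans hα h)
  one_mem := Submodule.subset_span ⟨0, by simp, by
    rw [S.basis_eq]
    simp⟩
  mul_mem hx hy := S.mul_mem _ _ _ _ hx hy
  exhaustive x := by
    refine ⟨∑ α ∈ (S.basis.repr x).support, ∑ i, S.m i * α i, ?_⟩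
    have hx := S.basis.linearCombination_repr x
    rw [Finsupp.linearCombination_apply] at hx
    refine hx.subst (motive := fun y => y ∈ S.F _) ?_
    refine Submodule.sum_mem _ fun α hα => Submodule.smul_mem _ _ (Submodule.subset_span ⟨α, ?_, rfl⟩)
    exact Finset.single_le_sum (f := fun α : Fin S.n → ℕ => ∑ i, S.m i * α i)
      (fun _ _ => Nat.zero_le _) hα

end Solvable

end SolvRes

/-! Strictness carries parts (i) and (ii). It lets every element of the image lying in `F_q` be
lifted to an element of `F_q`, so exactness passes to each degree of the Rees modules
(`exact_reesMap`) and, after correcting by an element of `F_{q-1}`, of the graded modules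
(`exact_grMap`). Freeness comes from coordinates: `F_q L` consists of the vectors whose `i`-th
coordinate lies in `F_{q - deg i} A`, and is zero when `deg i > q`.

Minimality is reduced to one condition, `IsMinimalOn`: the images of a proper subfamily of the
basis, with the degrees of that basis, never recover the filtration of the image. If a subfamily
generated homogeneously over `G(A)` or over the Rees algebra, its lifted coefficients would recover
this filtration, over `G(A)` by induction on the degree; see `isMinimalHomogeneousGenerating_sigmaE`
and `isMinimalHomogeneousGenerating_tildeE`.

For (iii), `F_0 A = K` because the weights are positive. Comparison maps `φ`, `ψ` between two
minimal covers exist by strictness. The endomorphism `ψ ∘ φ` differs from the identity by a map `ν`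
into the relations, whose coordinates of equal degree vanish: a nonzero one would be a unit and make
a generator redundant (`coord_eq_zero_of_isMinimalOn`). Thus `ν` strictly lowers degrees, is
nilpotent, and `ψ ∘ φ = 1 + ν` is a filtered automorphism (`bijective_of_comp_eq`). `exists_equiv`
repeats this along the resolution. -/

namespace SolvRes

universe u v w

/-! ### Homogeneous components, independence and exactness in graded modules. -/

section GradedGeneral

/-- Components are compared after embedding by `of`, so that degrees which are only propositionally
equal need no transport. -/
lemma of_apply_of {X : ℕ → Type*} [∀ q, AddCommGroup (X q)] (p q : ℕ) (x : X p) :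
    DirectSum.of X q (DirectSum.of X p x q) = if p = q then DirectSum.of X p x else 0 := by
  split_ifs with h
  · subst h; rw [DirectSum.of_eq_same]
  · rw [DirectSum.of_eq_of_ne _ _ _ (Ne.symm h), map_zero]

lemma of_smul_of_apply {𝒜 : ℕ → Type*} [∀ p, AddCommGroup (𝒜 p)] [DirectSum.GRing 𝒜]
    {X : ℕ → Type*} [∀ q, AddCommGroup (X q)] [DirectSum.Gmodule 𝒜 X]
    (q b : ℕ) (c : ⨁ p, 𝒜 p) (y : X b) :
    DirectSum.of X q ((c • DirectSum.of X b y) q) =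
      if b ≤ q then DirectSum.of 𝒜 (q - b) (c (q - b)) • DirectSum.of X b y else 0 := by
  induction c using DirectSum.induction_on with
  | zero => simp
  | add c d hc hd =>
    rw [add_smul, DirectSum.add_apply, map_add, hc, hd, DirectSum.add_apply, map_add, add_smul]
    split_ifs <;> simp
  | of p a =>
    rw [DirectSum.Gmodule.of_smul_of, of_apply_of, of_apply_of, ← DirectSum.Gmodule.of_smul_of]
    by_cases h : p + b = q
    · subst h; simp
    · rw [if_neg (show ¬ p +ᵥ b = q from h)]
      split_ifs with h1 h2
      · omega
      · rw [zero_smul]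
      · rfl

/-- The homogeneous components of a relation between homogeneous elements. -/
lemma of_apply_sum_smul_of {𝒜 : ℕ → Type*} [∀ p, AddCommGroup (𝒜 p)] [DirectSum.GRing 𝒜]
    {X : ℕ → Type*} [∀ q, AddCommGroup (X q)] [DirectSum.Gmodule 𝒜 X]
    {ι : Type*} (s : Finset ι) (q : ℕ) (b : ι → ℕ) (y : ∀ i, X (b i)) (c : ι → ⨁ p, 𝒜 p) :
    DirectSum.of X q ((∑ i ∈ s, c i • DirectSum.of X (b i) (y i)) q) =
      ∑ i ∈ s with b i ≤ q,
        DirectSum.of 𝒜 (q - b i) (c i (q - b i)) • DirectSum.of X (b i) (y i) := by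
  rw [DirectSum.sum_apply, map_sum, Finset.sum_filter]
  exact Finset.sum_congr rfl fun i _ => of_smul_of_apply q (b i) (c i) (y i)

/-- Taking the component of degree `q` of any relation makes the coefficients homogeneous. The index
set `s` drops the `i` with `b i > q`, for which the truncated `q - b i` has no meaning. -/
lemma exists_sum_of_mem_span {𝒜 : ℕ → Type*} [∀ p, AddCommGroup (𝒜 p)] [DirectSum.GRing 𝒜]
    {X : ℕ → Type*} [∀ q, AddCommGroup (X q)] [DirectSum.Gmodule 𝒜 X]
    {ι : Type*} [Fintype ι] {q : ℕ} {b : ι → ℕ} {y : ∀ i, X (b i)} {T : Set ι} {x : X q}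
    (hx : DirectSum.of X q x ∈ Submodule.span (⨁ p, 𝒜 p)
      ((fun i => DirectSum.of X (b i) (y i)) '' T)) :
    ∃ (s : Finset ι) (a : ∀ i, 𝒜 (q - b i)), (∀ i ∈ s, i ∈ T ∧ b i ≤ q) ∧
      DirectSum.of X q x =
        ∑ i ∈ s, DirectSum.of 𝒜 (q - b i) (a i) • DirectSum.of X (b i) (y i) := by
  classical
  obtain ⟨c, hc, h⟩ := (Finsupp.mem_span_image_iff_linearCombination _).1 hx
  rw [Finsupp.linearCombination_apply, Finsupp.sum] at h
  refine ⟨c.support.filter fun i => b i ≤ q, fun i => c i (q - b i), fun i hi => ?_, ?_⟩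
  · rw [Finset.mem_filter] at hi
    exact ⟨hc hi.1, hi.2⟩
  · rw [← of_apply_sum_smul_of, h, DirectSum.of_eq_same]

lemma linearIndependent_of_homogeneous {𝒜 : ℕ → Type*} [∀ p, AddCommGroup (𝒜 p)]
    [DirectSum.GRing 𝒜] {X : ℕ → Type*} [∀ q, AddCommGroup (X q)] [DirectSum.Gmodule 𝒜 X]
    {ι : Type*} [Fintype ι] {b : ι → ℕ} {y : ∀ i, X (b i)}
    (h : ∀ (q : ℕ) (a : ∀ i, 𝒜 (q - b i)),
      ∑ i with b i ≤ q, DirectSum.of 𝒜 (q - b i) (a i) • DirectSum.of X (b i) (y i) = 0 →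
        ∀ i, b i ≤ q → a i = 0) :
    LinearIndependent (⨁ p, 𝒜 p) (fun i => DirectSum.of X (b i) (y i)) := by
  classical
  rw [Fintype.linearIndependent_iff]
  intro c hc i
  refine DFinsupp.ext fun p => ?_
  -- The component `c i p` contributes to the relation exactly in degree `p + b i`.
  have key := h (p + b i) (fun j => c j (p + b i - b j)) ?_ i (by omega)
  · have e : p + b i - b i = p := by omega
    rw [e] at key
    exact key
  · rw [← of_apply_sum_smul_of, hc]
    simp

lemma span_eq_top_of_homogeneous {R : Type*} [Semiring R] {X : ℕ → Type*}
    [∀ q, AddCommGroup (X q)] [Module R (⨁ q, X q)] {N : Submodule R (⨁ q, X q)}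
    (h : ∀ q x, DirectSum.of X q x ∈ N) : N = ⊤ := by
  refine eq_top_iff.2 fun x _ => ?_
  induction x using DirectSum.induction_on with
  | zero => exact zero_mem _
  | add x y hx hy => exact add_mem (hx trivial) (hy trivial)
  | of q x => exact h q x

lemma exact_directSumMap {X Y Z : ℕ → Type*} [∀ q, AddCommGroup (X q)] [∀ q, AddCommGroup (Y q)]
    [∀ q, AddCommGroup (Z q)] {f : ∀ q, X q →+ Y q} {g : ∀ q, Y q →+ Z q}
    (h : ∀ q, Function.Exact (f q) (g q)) :
    Function.Exact (DirectSum.map f) (DirectSum.map g) := by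
  classical
  intro y
  constructor
  · intro hy
    have hq : ∀ q, ∃ x, f q x = y q := fun q => (h q (y q)).1 (by
      rw [← DirectSum.map_apply, hy]; rfl)
    choose x hx using hq
    -- The chosen preimage of `0` need not be `0`, so the preimages are used only on the finite
    -- support of `y`.
    refine ⟨DirectSum.mk X (DFinsupp.support y) fun q => x q, ?_⟩
    refine DFinsupp.ext fun q => ?_
    rw [DirectSum.map_apply]
    by_cases hqs : q ∈ DFinsupp.support y
    · rw [DirectSum.mk_apply_of_mem hqs, hx]
    · rw [DirectSum.mk_apply_of_notMem hqs, map_zero, DFinsupp.notMem_support_iff.1 hqs]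
  · rintro ⟨x, rfl⟩
    refine DFinsupp.ext fun q => ?_
    rw [DirectSum.map_apply, DirectSum.map_apply]
    exact (h q _).2 ⟨_, rfl⟩

lemma surjective_directSumMap {X Y : ℕ → Type*} [∀ q, AddCommGroup (X q)]
    [∀ q, AddCommGroup (Y q)] {f : ∀ q, X q →+ Y q} (h : ∀ q, Function.Surjective (f q)) :
    Function.Surjective (DirectSum.map f) := by
  intro y
  induction y using DirectSum.induction_on with
  | zero => exact ⟨0, map_zero _⟩
  | add y z hy hz =>
    obtain ⟨y, rfl⟩ := hy
    obtain ⟨z, rfl⟩ := hz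
    exact ⟨y + z, map_add _ _ _⟩
  | of q y =>
    obtain ⟨x, rfl⟩ := h q y
    exact ⟨DirectSum.of X q x, DirectSum.map_of _ _ _⟩

/-- Homogeneity and generation are inherited from `E`, so only the irredundancy `hmin` has to be
checked for each map. -/
lemma isMinimalHomogeneousGenerating_of_range {𝒜 : ℕ → Type*} [∀ p, AddCommGroup (𝒜 p)]
    [DirectSum.GRing 𝒜] {X Y : ℕ → Type*} [∀ q, AddCommGroup (X q)] [∀ q, AddCommGroup (Y q)]
    [DirectSum.Gmodule 𝒜 X] [DirectSum.Gmodule 𝒜 Y] {f : GMap 𝒜 X Y} (hf : IsGradedHom f)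
    {ι : Type*} {E : ι → ⨁ q, X q} (hE : ∀ i, ∃ q, IsHomogeneousOfDegree q (E i))
    (hspan : Submodule.span (⨁ p, 𝒜 p) (Set.range E) = ⊤)
    {N : Submodule (⨁ p, 𝒜 p) (⨁ q, Y q)} (hN : LinearMap.range f = N)
    (hmin : ∀ T : Set ι, (∀ x, f x ∈ Submodule.span (⨁ p, 𝒜 p) ((fun i => f (E i)) '' T)) →
      T = Set.univ) :
    IsMinimalHomogeneousGenerating 𝒜 N (fun i => f (E i)) := by
  refine ⟨fun i => ?_, ?_, fun T hT h => hT (hmin T fun x => ?_)⟩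
  · obtain ⟨q, hq⟩ := hE i
    exact ⟨q, hf q _ hq⟩
  · rw [← hN, LinearMap.range_eq_map, ← hspan, Submodule.map_span, ← Set.range_comp]
    rfl
  · rw [h, ← hN]
    exact LinearMap.mem_range_self f x

end GradedGeneral

/-! ### Coordinates in filtered free modules and the minimality condition. -/

section FilteredGeneral

variable {K : Type u} [Field K] {A : Type v} [Ring A] [Algebra K A]
variable {FA : ℕ → Submodule K A}

lemma lower_le {M : Type w} [AddCommGroup M] [Module K M] {FM : ℕ → Submodule K M}
    (h : Monotone FM) (q : ℕ) : lower FM q ≤ FM q := by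
  cases q with
  | zero => exact bot_le
  | succ q => exact h (Nat.le_succ q)

namespace FilteredFree

lemma sum_smul_e (L : FilteredFree) (x : L.Carrier A) : ∑ i, x i • L.e A i = x := by
  simpa [e, ← Pi.single_smul] using Finset.univ_sum_single x

lemma sum_smul_e_apply (L : FilteredFree) (a : Fin L.rank → A) (s : Finset (Fin L.rank))
    (j : Fin L.rank) : (∑ i ∈ s, a i • L.e A i) j = if j ∈ s then a j else 0 := by
  simp [e, Finset.sum_apply, Pi.single_apply]

variable [IsAlgFiltration FA]

/-- The alternative `x j = 0` cannot be absorbed: when `deg j > q` the truncated difference is `0`,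
and membership in `F_0 A` would be too weak. -/
lemma coord_of_mem_fil {L : FilteredFree} {q : ℕ} {x : L.Carrier A} (hx : x ∈ L.fil FA q)
    (j : Fin L.rank) : x j = 0 ∨ L.deg j ≤ q ∧ x j ∈ FA (q - L.deg j) := by
  induction hx using Submodule.span_induction with
  | mem x hx =>
    obtain ⟨i, p, a, hp, ha, rfl⟩ := hx
    by_cases h : i = j
    · subst h
      refine Or.inr ⟨by omega, IsAlgFiltration.mono (FA := FA) (show p ≤ q - L.deg i by omega) ?_⟩
      simpa [e] using ha
    · left
      simp [e, h]
  | zero => exact Or.inl rfl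
  | add x y _ _ hx hy =>
    rcases hx with hx | hx
    · simpa [hx] using hy
    · rcases hy with hy | hy
      · simpa [hy] using Or.inr hx
      · exact Or.inr ⟨hx.1, add_mem hx.2 hy.2⟩
  | smul c x _ hx =>
    rcases hx with hx | hx
    · left; simp [hx]
    · exact Or.inr ⟨hx.1, Submodule.smul_mem _ c hx.2⟩

lemma coord_of_mem_lower {L : FilteredFree} {q : ℕ} {x : L.Carrier A}
    (hx : x ∈ lower (L.fil FA) q) (j : Fin L.rank) (hj : L.deg j ≤ q) :
    x j ∈ lower FA (q - L.deg j) := by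
  cases q with
  | zero =>
    have : x = 0 := by simpa [lower] using hx
    simp [this]
  | succ q =>
    rcases coord_of_mem_fil hx j with h | ⟨h, h'⟩
    · rw [h]; exact zero_mem _
    · rw [show q + 1 - L.deg j = (q - L.deg j) + 1 by omega]
      exact h'

/-- An element of `F_q L` is a combination of the `e_i` with coefficients in `F_{q - deg i} A`. -/
lemma exists_coord {L : FilteredFree} {q : ℕ} {x : L.Carrier A} (hx : x ∈ L.fil FA q) :
    ∃ a : ∀ i, FA (q - L.deg i), x = ∑ i with L.deg i ≤ q, (a i : A) • L.e A i := by
  refine ⟨fun i => ⟨x i, ?_⟩, ?_⟩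
  · rcases coord_of_mem_fil hx i with h | h
    · rw [h]; exact zero_mem _
    · exact h.2
  · funext j
    rw [sum_smul_e_apply _ (fun i => x i)]
    split_ifs with h
    · rfl
    · rw [Finset.mem_filter, not_and] at h
      exact (coord_of_mem_fil hx j).resolve_right fun h' => h (Finset.mem_univ _) h'.1

end FilteredFree

lemma goodFil_mono (FA : ℕ → Submodule K A) {M : Type w} [AddCommGroup M] [Module K M] [Module A M]
    {ι : Type*} (v : ι → M) (n : ι → ℕ) : Monotone (goodFil FA v n) := by
  intro q r h
  apply Submodule.span_mono
  rintro _ ⟨i, p, a, hp, ha, rfl⟩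
  exact ⟨i, p, a, hp.trans h, ha, rfl⟩

/-- No proper subfamily of the images of the basis elements determines the filtration of the
image of `f`. -/
def IsMinimalOn (FA : ℕ → Submodule K A) {M : Type w} [AddCommGroup M] [Module K M] [Module A M]
    (L : FilteredFree) (f : L.Carrier A →ₗ[A] M) : Prop :=
  ∀ T : Set (Fin L.rank),
    (∀ q, ∀ x ∈ L.fil FA q, f x ∈ goodFil FA (fun i : T => f (L.e A i)) (fun i => L.deg i) q) →
      T = Set.univ

section
variable {M : Type w} [AddCommGroup M] [Module K M] [Module A M] [IsScalarTower K A M]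
  {L : FilteredFree} {f : L.Carrier A →ₗ[A] M} {FM : ℕ → Submodule K M}

lemma exists_of_mem_goodFil {T : Set (Fin L.rank)} {q : ℕ} {y : M}
    (hy : y ∈ goodFil FA (fun i : T => f (L.e A i)) (fun i => L.deg i) q) :
    ∃ x ∈ L.fil FA q, f x = y := by
  induction hy using Submodule.span_induction with
  | mem x hx =>
    obtain ⟨i, r, b, hr, hb, rfl⟩ := hx
    exact ⟨b • L.e A i, Submodule.subset_span ⟨i, r, b, hr, hb, rfl⟩, map_smul _ _ _⟩
  | zero => exact ⟨0, zero_mem _, map_zero _⟩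
  | add y z _ _ hy hz =>
    obtain ⟨y, hy, rfl⟩ := hy
    obtain ⟨z, hz, rfl⟩ := hz
    exact ⟨y + z, add_mem hy hz, map_add _ _ _⟩
  | smul c y _ hy =>
    obtain ⟨y, hy, rfl⟩ := hy
    exact ⟨c • y, Submodule.smul_mem _ c hy, map_smul (f.restrictScalars K) c y⟩

/-- Standard bases live in the submodule `N`, whereas `IsMinimalOn` is tested in the ambient module;
this passes between the two. -/
lemma mem_goodFil_coe {N : Submodule A M} {ι : Type*} {v : ι → N} {n : ι → ℕ} {q : ℕ} {x : N} :
    x ∈ goodFil FA v n q ↔ (x : M) ∈ goodFil FA (fun i => (v i : M)) n q := by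
  have : goodFil FA (fun i => (v i : M)) n q =
      (goodFil FA v n q).map (N.subtype.restrictScalars K) := by
    rw [goodFil, goodFil, Submodule.map_span]
    congr 1
    ext y
    constructor
    · rintro ⟨i, p, a, hp, ha, rfl⟩
      exact ⟨a • v i, ⟨i, p, a, hp, ha, rfl⟩, rfl⟩
    · rintro ⟨_, ⟨i, p, a, hp, ha, rfl⟩, rfl⟩
      exact ⟨i, p, a, hp, ha, rfl⟩
  rw [this]
  constructor
  · intro h
    exact ⟨x, h, rfl⟩
  · rintro ⟨y, hy, h⟩
    rwa [← Subtype.ext (a1 := y) (a2 := x) h]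

/-- Minimality of the standard basis excludes a proper subfamily for every choice of degrees, in
particular for those of `L`. With these, one inclusion of filtrations is strictness followed by the
assumption on `T`; the other holds because `f` is filtered. -/
lemma isMinimalOn_of_isMinimalStandardBasis (hf : IsStrictFiltered (L.fil FA) FM f)
    {N : Submodule A M} (hN : ∀ y, y ∈ N ↔ y ∈ Set.range f)
    (h : IsMinimalStandardBasis FA FM N (fun i => f (L.e A i))) : IsMinimalOn FA L f := by
  intro T hT
  by_contra hne
  obtain ⟨hmem, hB, hmin⟩ := h
  refine hmin T hne ⟨fun i => hB.1 i, fun i => L.deg i, fun q => ?_⟩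
  ext y
  rw [mem_goodFil_coe]
  constructor
  · intro hy
    obtain ⟨x, hx, hxy⟩ := (hf q).superset ⟨(hN y).1 y.2, hy⟩
    rw [← hxy]
    exact hT q x hx
  · intro hy
    obtain ⟨x, hx, hxy⟩ := exists_of_mem_goodFil hy
    show (y : M) ∈ FM q
    rw [← hxy]
    exact hf.isFiltered q x hx

lemma isMinimalOn_of_isMinimalFBasis (hf : ∀ q, f '' (L.fil FA q : Set (L.Carrier A)) = FM q)
    (h : IsMinimalFBasis FA FM (fun i => f (L.e A i))) : IsMinimalOn FA L f := by
  intro T hT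
  by_contra hne
  refine h.2 T hne ⟨fun i => h.1.1 i, fun i => L.deg i, fun q => ?_⟩
  ext y
  rw [← SetLike.mem_coe, ← hf q]
  constructor
  · rintro ⟨x, hx, rfl⟩
    exact hT q x hx
  · intro hy
    exact exists_of_mem_goodFil hy

end

end FilteredGeneral

/-! ### Graded and Rees maps: exactness, freeness, minimal generation. -/

section InducedMaps

variable {K : Type u} [Field K] {A : Type v} [Ring A] [Algebra K A]
variable {FA : ℕ → Submodule K A} [IsAlgFiltration FA]

section General

variable {M M' M'' : Type*} [AddCommGroup M] [Module K M] [Module A M] [IsScalarTower K A M]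
  [AddCommGroup M'] [Module K M'] [Module A M'] [IsScalarTower K A M']
  [AddCommGroup M''] [Module K M''] [Module A M''] [IsScalarTower K A M'']
  {FM : ℕ → Submodule K M} {FM' : ℕ → Submodule K M'} {FM'' : ℕ → Submodule K M''}
  [IsModFiltration FA FM] [IsModFiltration FA FM'] [IsModFiltration FA FM'']

lemma grMap_of {f : M →ₗ[A] M'} (hf : IsFiltered FM FM' f) (q : ℕ) (x : FM q) :
    grMap FA f hf (DirectSum.of (Gr FM) q (Gr.mk FM q x)) =
      DirectSum.of (Gr FM') q (Gr.mk FM' q ⟨f x, hf q x x.2⟩) :=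
  DirectSum.map_of _ _ _

lemma reesMap_of {f : M →ₗ[A] M'} (hf : IsFiltered FM FM' f) (q : ℕ) (x : FM q) :
    reesMap FA f hf (DirectSum.of (Rees FM) q x) =
      DirectSum.of (Rees FM') q ⟨f x, hf q x x.2⟩ :=
  DirectSum.map_of _ _ _

lemma isGradedHom_grMap {f : M →ₗ[A] M'} (hf : IsFiltered FM FM' f) :
    IsGradedHom (grMap FA f hf) := by
  rintro q _ ⟨x, rfl⟩
  exact ⟨_, (DirectSum.map_of _ _ _).symm⟩

lemma isGradedHom_reesMap {f : M →ₗ[A] M'} (hf : IsFiltered FM FM' f) :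
    IsGradedHom (reesMap FA f hf) := by
  rintro q _ ⟨x, rfl⟩
  exact ⟨_, (DirectSum.map_of _ _ _).symm⟩

lemma surjective_grMap {f : M →ₗ[A] M'} (hf : IsFiltered FM FM' f)
    (h : ∀ q, f '' (FM q : Set M) = FM' q) : Function.Surjective (grMap FA f hf) := by
  refine surjective_directSumMap fun q y => ?_
  obtain ⟨y, rfl⟩ := Gr.mk_surjective y
  obtain ⟨x, hx, hxy⟩ := (h q).superset y.2
  exact ⟨Gr.mk FM q ⟨x, hx⟩, congrArg (Gr.mk FM' q) (Subtype.ext hxy)⟩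

lemma surjective_reesMap {f : M →ₗ[A] M'} (hf : IsFiltered FM FM' f)
    (h : ∀ q, f '' (FM q : Set M) = FM' q) : Function.Surjective (reesMap FA f hf) := by
  refine surjective_directSumMap fun q y => ?_
  obtain ⟨x, hx, hxy⟩ := (h q).superset y.2
  exact ⟨⟨x, hx⟩, Subtype.ext hxy⟩

/-- Strictness one step down; in degree `0` the convention `F_{-1} = 0` is met by the lift `0`. -/
lemma IsStrictFiltered.exists_of_lower {f : M →ₗ[A] M'} (hf : IsStrictFiltered FM FM' f) {q : ℕ}
    {x : M} (hx : f x ∈ lower FM' q) : ∃ y ∈ lower FM q, f y = f x := by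
  cases q with
  | zero => exact ⟨0, zero_mem _, by rw [map_zero, (Submodule.mem_bot K).1 hx]⟩
  | succ q => exact (hf q).superset ⟨⟨x, rfl⟩, hx⟩

/-- Both maps must be strict. A cycle in `G(M')_q` only satisfies `g y ∈ F_{q-1}`; strictness of `g`
provides `z ∈ F_{q-1}` with `g z = g y`, so `y - z` is a true cycle with the same class, and
strictness of `f` lifts it to `F_q`. -/
lemma exact_grMap {f : M →ₗ[A] M'} {g : M' →ₗ[A] M''} (hf : IsStrictFiltered FM FM' f)
    (hg : IsStrictFiltered FM' FM'' g) (h : Function.Exact f g) :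
    Function.Exact (grMap FA f hf.isFiltered) (grMap FA g hg.isFiltered) := by
  refine exact_directSumMap fun q y => ?_
  obtain ⟨y, rfl⟩ := Gr.mk_surjective y
  constructor
  · intro hy
    have hy' : g y ∈ lower FM'' q := Gr.mk_eq_zero.1 hy
    obtain ⟨z, hz, hzy⟩ := hg.exists_of_lower hy'
    have hz' := lower_le (IsModFiltration.mono FA (FM := FM')) q hz
    obtain ⟨x, hx, hxy⟩ := (hf q).superset
      ⟨(h (y - z)).1 (by rw [map_sub, hzy, sub_self]), sub_mem y.2 hz'⟩
    refine ⟨Gr.mk FM q ⟨x, hx⟩, ?_⟩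
    have : Gr.mk FM' q (⟨f x, hf.isFiltered q x hx⟩ - y) = 0 := by
      rw [Gr.mk_eq_zero]
      have : f x - y = - z := by rw [hxy]; abel
      change f x - y ∈ lower FM' q
      rw [this]
      exact neg_mem hz
    rw [map_sub, sub_eq_zero] at this
    exact this
  · rintro ⟨x, hx⟩
    obtain ⟨x, rfl⟩ := Gr.mk_surjective x
    rw [← hx]
    refine (congrArg (Gr.mk FM'' q) (Subtype.ext ?_)).trans (map_zero _)
    exact (h _).2 ⟨x, rfl⟩

/-- A cycle of degree `q` is already a cycle in `M'`, so only `f` needs to be strict. -/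
lemma exact_reesMap {f : M →ₗ[A] M'} {g : M' →ₗ[A] M''} (hf : IsStrictFiltered FM FM' f)
    (hg : IsFiltered FM' FM'' g) (h : Function.Exact f g) :
    Function.Exact (reesMap FA f hf.isFiltered) (reesMap FA g hg) := by
  refine exact_directSumMap fun q y => ?_
  constructor
  · intro hy
    obtain ⟨x, hx, hxy⟩ := (hf q).superset ⟨(h y).1 (congrArg Subtype.val hy), y.2⟩
    exact ⟨⟨x, hx⟩, Subtype.ext hxy⟩
  · rintro ⟨x, rfl⟩
    refine Subtype.ext ?_
    exact (h _).2 ⟨x, rfl⟩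

lemma gr_of_smul_of {q b : ℕ} (hb : b ≤ q) (a : FA (q - b)) (x : FM b)
    (h : (a : A) • (x : M) ∈ FM q) :
    DirectSum.of (Gr FA) (q - b) (Gr.mk FA _ a) • DirectSum.of (Gr FM) b (Gr.mk FM b x) =
      DirectSum.of (Gr FM) q (Gr.mk FM q ⟨(a : A) • (x : M), h⟩) := by
  rw [DirectSum.Gmodule.of_smul_of]
  exact DirectSum.of_eq_of_gradedMonoid_eq
    (Gr.sigma_ext (x := ⟨(a : A) • (x : M), IsModFiltration.smul_mem a.2 x.2⟩)
      (Nat.sub_add_cancel hb) rfl)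

lemma rees_of_smul_of {q b : ℕ} (hb : b ≤ q) (a : FA (q - b)) (x : FM b)
    (h : (a : A) • (x : M) ∈ FM q) :
    DirectSum.of (Rees FA) (q - b) a • DirectSum.of (Rees FM) b x =
      DirectSum.of (Rees FM) q ⟨(a : A) • (x : M), h⟩ := by
  rw [DirectSum.Gmodule.of_smul_of]
  refine DirectSum.of_eq_of_gradedMonoid_eq ?_
  exact Sigma.subtype_ext (Nat.sub_add_cancel hb) rfl

/-- A homogeneous combination of the classes of the `x i` is the class of a combination. -/
lemma gr_sum_smul {ι : Type*} (s : Finset ι) {q : ℕ} {b : ι → ℕ} (hb : ∀ i ∈ s, b i ≤ q)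
    (a : ∀ i, FA (q - b i)) (x : ∀ i, FM (b i))
    (h : ∑ i ∈ s, (a i : A) • (x i : M) ∈ FM q) :
    ∑ i ∈ s, DirectSum.of (Gr FA) (q - b i) (Gr.mk FA _ (a i)) •
        DirectSum.of (Gr FM) (b i) (Gr.mk FM (b i) (x i)) =
      DirectSum.of (Gr FM) q (Gr.mk FM q ⟨∑ i ∈ s, (a i : A) • (x i : M), h⟩) := by
  classical
  induction s using Finset.induction_on with
  | empty =>
    simp only [Finset.sum_empty]
    exact ((congrArg _ (map_zero (Gr.mk FM q))).trans (map_zero _)).symm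
  | insert i s hi ih =>
    have hmem : ∀ j ∈ insert i s, (a j : A) • (x j : M) ∈ FM q := fun j hj => by
      have := IsModFiltration.smul_mem (FA := FA) (FM := FM) (a j).2 (x j).2
      rwa [Nat.sub_add_cancel (hb j hj)] at this
    have hs := Submodule.sum_mem (FM q) fun j hj => hmem j (Finset.mem_insert_of_mem (a := j) hj)
    have hi' := hmem i (Finset.mem_insert_self i s)
    rw [Finset.sum_insert hi, ih (fun j hj => hb j (Finset.mem_insert_of_mem hj)) hs,
      gr_of_smul_of (hb i (Finset.mem_insert_self i s)) _ _ hi', ← map_add, ← map_add]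
    refine congrArg _ (congrArg _ (Subtype.ext ?_))
    exact (Finset.sum_insert (f := fun i => (a i : A) • (x i : M)) hi).symm

lemma rees_sum_smul {ι : Type*} (s : Finset ι) {q : ℕ} {b : ι → ℕ} (hb : ∀ i ∈ s, b i ≤ q)
    (a : ∀ i, FA (q - b i)) (x : ∀ i, FM (b i))
    (h : ∑ i ∈ s, (a i : A) • (x i : M) ∈ FM q) :
    ∑ i ∈ s, DirectSum.of (Rees FA) (q - b i) (a i) • DirectSum.of (Rees FM) (b i) (x i) =
      DirectSum.of (Rees FM) q ⟨∑ i ∈ s, (a i : A) • (x i : M), h⟩ := by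
  classical
  induction s using Finset.induction_on with
  | empty =>
    simp only [Finset.sum_empty]
    exact (map_zero (DirectSum.of (Rees FM) q)).symm
  | insert i s hi ih =>
    have hmem : ∀ j ∈ insert i s, (a j : A) • (x j : M) ∈ FM q := fun j hj => by
      have := IsModFiltration.smul_mem (FA := FA) (FM := FM) (a j).2 (x j).2
      rwa [Nat.sub_add_cancel (hb j hj)] at this
    have hs := Submodule.sum_mem (FM q) fun j hj => hmem j (Finset.mem_insert_of_mem (a := j) hj)
    have hi' := hmem i (Finset.mem_insert_self i s)
    rw [Finset.sum_insert hi, ih (fun j hj => hb j (Finset.mem_insert_of_mem hj)) hs,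
      rees_of_smul_of (hb i (Finset.mem_insert_self i s)) _ _ hi', ← map_add]
    refine congrArg _ (Subtype.ext ?_)
    exact (Finset.sum_insert (f := fun i => (a i : A) • (x i : M)) hi).symm

end General

section Free

variable (L : FilteredFree)

/-- A homogeneous relation of degree `q` says that `∑ α i e_i` lies in `F_{q-1} L`; then each `α i`
drops one step in the filtration of `A`, and its class is zero. -/
lemma linearIndependent_sigmaE : LinearIndependent (⨁ p, Gr FA p) (L.sigmaE FA) := by
  refine linearIndependent_of_homogeneous fun q a h i hi => ?_
  choose α hα using fun i => Gr.mk_surjective (a i)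
  obtain rfl : a = fun i => Gr.mk FA _ (α i) := funext fun i => (hα i).symm
  have hmem : ∑ i with L.deg i ≤ q, (α i : A) • L.e A i ∈ L.fil FA q :=
    Submodule.sum_mem _ fun i hi => Submodule.subset_span
      ⟨i, _, α i, (Nat.sub_add_cancel (Finset.mem_filter.1 hi).2).le, (α i).2, rfl⟩
  rw [gr_sum_smul (FM := L.fil FA) _ (fun i hi => (Finset.mem_filter.1 hi).2) α _ hmem] at h
  have h' := Gr.mk_eq_zero.1 (DirectSum.of_injective q (h.trans (map_zero _).symm))
  have := FilteredFree.coord_of_mem_lower h' i hi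
  refine Gr.mk_eq_zero.2 ?_
  dsimp only at this
  rw [FilteredFree.sum_smul_e_apply L (fun i => (α i : A))] at this
  simpa only [Finset.mem_filter_univ, hi, if_true] using this

lemma linearIndependent_tildeE : LinearIndependent (⨁ p, Rees FA p) (L.tildeE FA) := by
  refine linearIndependent_of_homogeneous fun q a h i hi => ?_
  have hmem : ∑ i with L.deg i ≤ q, (a i : A) • L.e A i ∈ L.fil FA q :=
    Submodule.sum_mem _ fun i hi => Submodule.subset_span
      ⟨i, _, a i, (Nat.sub_add_cancel (Finset.mem_filter.1 hi).2).le, (a i).2, rfl⟩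
  rw [rees_sum_smul (FM := L.fil FA) _ (fun i hi => (Finset.mem_filter.1 hi).2) a _ hmem] at h
  have h' := congrArg Subtype.val (DirectSum.of_injective q (h.trans (map_zero _).symm))
  have := congrFun h' i
  dsimp only at this
  rw [FilteredFree.sum_smul_e_apply L (fun i => (a i : A))] at this
  simp only [Finset.mem_filter_univ, hi, if_true] at this
  exact Subtype.ext this

lemma span_sigmaE : Submodule.span (⨁ p, Gr FA p) (Set.range (L.sigmaE FA)) = ⊤ := by
  refine span_eq_top_of_homogeneous fun q x => ?_
  obtain ⟨⟨x, hx⟩, rfl⟩ := Gr.mk_surjective x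
  obtain ⟨a, rfl⟩ := FilteredFree.exists_coord hx
  have := gr_sum_smul (FM := L.fil FA) (Finset.univ.filter fun i => L.deg i ≤ q)
    (fun i hi => (Finset.mem_filter.1 hi).2) a
    (fun i => ⟨L.e A i, L.e_mem_fil FA i⟩) hx
  rw [← this]
  exact Submodule.sum_mem _ fun i _ => Submodule.smul_mem _ _ (Submodule.subset_span ⟨i, rfl⟩)

lemma span_tildeE : Submodule.span (⨁ p, Rees FA p) (Set.range (L.tildeE FA)) = ⊤ := by
  refine span_eq_top_of_homogeneous fun q x => ?_
  obtain ⟨x, hx⟩ := x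
  obtain ⟨a, rfl⟩ := FilteredFree.exists_coord hx
  have := rees_sum_smul (FM := L.fil FA) (Finset.univ.filter fun i => L.deg i ≤ q)
    (fun i hi => (Finset.mem_filter.1 hi).2) a
    (fun i => ⟨L.e A i, L.e_mem_fil FA i⟩) hx
  rw [← this]
  exact Submodule.sum_mem _ fun i _ => Submodule.smul_mem _ _ (Submodule.subset_span ⟨i, rfl⟩)

variable {L} {M : Type w} [AddCommGroup M] [Module K M] [Module A M] [IsScalarTower K A M]
  {FM : ℕ → Submodule K M} [IsModFiltration FA FM] {f : L.Carrier A →ₗ[A] M}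

lemma sum_mem_goodFil {T : Set (Fin L.rank)} {q : ℕ} {s : Finset (Fin L.rank)}
    (hs : ∀ i ∈ s, i ∈ T ∧ L.deg i ≤ q) (a : ∀ i, FA (q - L.deg i)) :
    ∑ i ∈ s, (a i : A) • f (L.e A i) ∈
      goodFil FA (fun i : T => f (L.e A i)) (fun i => L.deg i) q :=
  Submodule.sum_mem _ fun i hi => Submodule.subset_span
    ⟨⟨i, (hs i hi).1⟩, _, a i, (Nat.sub_add_cancel (hs i hi).2).le, (a i).2, rfl⟩

lemma isMinimalHomogeneousGenerating_sigmaE (hf : IsStrictFiltered (L.fil FA) FM f)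
    (hmin : IsMinimalOn FA L f) {N : Submodule (⨁ p, Gr FA p) (⨁ q, Gr FM q)}
    (hN : LinearMap.range (grMap FA f hf.isFiltered) = N) :
    IsMinimalHomogeneousGenerating (Gr FA) N
      (fun i => grMap FA f hf.isFiltered (L.sigmaE FA i)) := by
  refine isMinimalHomogeneousGenerating_of_range (isGradedHom_grMap _) (fun i => ⟨_, _, rfl⟩)
    (span_sigmaE L) hN fun T hT => hmin T ?_
  -- Generation by `T` in degree `q` holds modulo `F_{q-1}`; the error lies in the image, so
  -- strictness writes it as `f y` with `y` one step lower.
  have hstep : ∀ q, ∀ x ∈ L.fil FA q, ∃ y ∈ lower (L.fil FA) q,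
      f x - f y ∈ goodFil FA (fun i : T => f (L.e A i)) (fun i => L.deg i) q := by
    intro q x hx
    have h := hT (DirectSum.of (Gr (L.fil FA)) q (Gr.mk _ q ⟨x, hx⟩))
    simp only [grMap_of] at h
    obtain ⟨s, a, hs, h⟩ := exists_sum_of_mem_span h
    choose α hα using fun i => Gr.mk_surjective (a i)
    obtain rfl : a = fun i => Gr.mk FA _ (α i) := funext fun i => (hα i).symm
    have hz : ∑ i ∈ s, (α i : A) • L.e A i ∈ L.fil FA q :=
      Submodule.sum_mem _ fun i hi => Submodule.subset_span
        ⟨i, _, α i, (Nat.sub_add_cancel (hs i hi).2).le, (α i).2, rfl⟩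
    have hfz : f (∑ i ∈ s, (α i : A) • L.e A i) = ∑ i ∈ s, (α i : A) • f (L.e A i) := by
      simp only [map_sum, map_smul]
    have hmem := hf.isFiltered q _ hz
    rw [hfz] at hmem
    rw [gr_sum_smul (FM := FM) s (fun i hi => (hs i hi).2) α
      (fun i => ⟨f (L.e A i), hf.isFiltered _ _ (L.e_mem_fil FA i)⟩) hmem] at h
    have h' := DirectSum.of_injective q h
    rw [← sub_eq_zero, ← map_sub, Gr.mk_eq_zero] at h'
    have h'' : f (x - ∑ i ∈ s, (α i : A) • L.e A i) ∈ lower FM q := by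
      rw [map_sub, hfz]
      exact h'
    obtain ⟨y, hy, hxy⟩ := hf.exists_of_lower h''
    refine ⟨y, hy, ?_⟩
    rw [hxy, map_sub, sub_sub_cancel, hfz]
    exact sum_mem_goodFil hs α
  -- Iterating `hstep` pushes the error down until it lies in `F_{-1} = 0`.
  intro q
  induction q with
  | zero =>
    intro x hx
    obtain ⟨y, hy, h⟩ := hstep 0 x hx
    have : y = 0 := (Submodule.mem_bot K).1 hy
    rwa [this, map_zero, sub_zero] at h
  | succ q ih =>
    intro x hx
    obtain ⟨y, hy, h⟩ := hstep (q + 1) x hx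
    have := add_mem h (goodFil_mono FA _ _ (Nat.le_succ q) (ih y hy))
    rwa [sub_add_cancel] at this

/-- The Rees module keeps all of `F_q` in degree `q`, so a homogeneous expression is an equality in
`M` itself: no induction and no strictness are needed. -/
lemma isMinimalHomogeneousGenerating_tildeE (hf : IsFiltered (L.fil FA) FM f)
    (hmin : IsMinimalOn FA L f) {N : Submodule (⨁ p, Rees FA p) (⨁ q, Rees FM q)}
    (hN : LinearMap.range (reesMap FA f hf) = N) :
    IsMinimalHomogeneousGenerating (Rees FA) N (fun i => reesMap FA f hf (L.tildeE FA i)) := by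
  refine isMinimalHomogeneousGenerating_of_range (isGradedHom_reesMap _) (fun i => ⟨_, _, rfl⟩)
    (span_tildeE L) hN fun T hT => hmin T fun q x hx => ?_
  have h := hT (DirectSum.of (Rees (L.fil FA)) q ⟨x, hx⟩)
  simp only [reesMap_of] at h
  obtain ⟨s, a, hs, h⟩ := exists_sum_of_mem_span h
  have hz : ∑ i ∈ s, (a i : A) • L.e A i ∈ L.fil FA q :=
    Submodule.sum_mem _ fun i hi => Submodule.subset_span
      ⟨i, _, a i, (Nat.sub_add_cancel (hs i hi).2).le, (a i).2, rfl⟩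
  have hmem := hf q _ hz
  simp only [map_sum, map_smul] at hmem
  rw [rees_sum_smul (FM := FM) s (fun i hi => (hs i hi).2) a
    (fun i => ⟨f (L.e A i), hf _ _ (L.e_mem_fil FA i)⟩) hmem] at h
  have h' : f x = _ := congrArg Subtype.val (DirectSum.of_injective q h)
  rw [h']
  exact sum_mem_goodFil hs a

end Free

end InducedMaps

/-! ### Lifting through strict maps and rigidity of minimal ones. -/

section Lifting

variable {K : Type u} [Field K] {A : Type v} [Ring A] [Algebra K A]
variable {FA : ℕ → Submodule K A} [IsAlgFiltration FA]
variable {L L' : FilteredFree}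
variable {M : Type w} [AddCommGroup M] [Module K M] [Module A M] [IsScalarTower K A M]
  {FM : ℕ → Submodule K M}

lemma smul_mem_fil_of_coord {q : ℕ} {x : L.Carrier A} (hx : x ∈ L.fil FA q) (j : Fin L.rank)
    {z : M} [IsModFiltration FA FM] (hz : z ∈ FM (L.deg j)) : x j • z ∈ FM q := by
  rcases FilteredFree.coord_of_mem_fil hx j with h | ⟨h, h'⟩
  · rw [h, zero_smul]; exact zero_mem _
  · have := IsModFiltration.smul_mem (FA := FA) (FM := FM) h' hz
    rwa [Nat.sub_add_cancel h] at this

lemma map_eq_sum (f : L.Carrier A →ₗ[A] M) (x : L.Carrier A) :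
    f x = ∑ i, x i • f (L.e A i) := by
  conv_lhs => rw [← L.sum_smul_e x]
  simp only [map_sum, map_smul]

lemma isFiltered_of_map_e_mem [IsModFiltration FA FM] {f : L.Carrier A →ₗ[A] M}
    (h : ∀ j, f (L.e A j) ∈ FM (L.deg j)) : IsFiltered (L.fil FA) FM f := by
  intro q x hx
  rw [map_eq_sum]
  exact Submodule.sum_mem _ fun j _ => smul_mem_fil_of_coord hx j (h j)

variable {f : L.Carrier A →ₗ[A] M}

/-- A relation of degree `deg j` between the images of the basis elements does not involve
the `j`-th one. -/
lemma coord_eq_zero_of_isMinimalOn (hF : ∀ a ∈ FA 0, a ≠ 0 → ∃ b ∈ FA 0, b * a = 1)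
    (hmin : IsMinimalOn FA L f) {j : Fin L.rank} {x : L.Carrier A}
    (hx : x ∈ L.fil FA (L.deg j)) (hfx : f x = 0) : x j = 0 := by
  by_contra hne
  have hxj : x j ∈ FA 0 := by
    have := ((FilteredFree.coord_of_mem_fil hx j).resolve_left hne).2
    rwa [Nat.sub_self] at this
  obtain ⟨b, hb, hbx⟩ := hF _ hxj hne
  have hbx' : b • x ∈ L.fil FA (L.deg j) := by
    have := IsModFiltration.smul_mem (FA := FA) (FM := L.fil FA) hb hx
    rwa [Nat.zero_add] at this
  -- This vector has `j`-th coordinate `0` and the same image as `e_j`, which makes the `j`-th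
  -- generator redundant.
  have hz : L.e A j - b • x ∈ L.fil FA (L.deg j) := sub_mem (L.e_mem_fil FA j) hbx'
  have hT : {i | i ≠ j} = (Set.univ : Set (Fin L.rank)) := by
    refine hmin _ fun q y hy => ?_
    have key : ∀ w ∈ L.fil FA q, w j = 0 →
        f w ∈ goodFil FA (fun i : {i | i ≠ j} => f (L.e A i)) (fun i => L.deg i) q := by
      intro w hw hwj
      rw [map_eq_sum]
      refine Submodule.sum_mem _ fun i _ => ?_
      rcases FilteredFree.coord_of_mem_fil hw i with h | ⟨h, h'⟩
      · rw [h, zero_smul]; exact zero_mem _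
      · by_cases hij : i = j
        · rw [hij, hwj, zero_smul]; exact zero_mem _
        · exact Submodule.subset_span ⟨⟨i, hij⟩, _, w i, (Nat.sub_add_cancel h).le, h', rfl⟩
    -- Replacing `y j • e_j` by `y j • (e_j - b • x)` kills the `j`-th coordinate without changing
    -- the image or leaving `F_q L`.
    have := key (y - y j • L.e A j + y j • (L.e A j - b • x))
      (add_mem (sub_mem hy (smul_mem_fil_of_coord hy j (L.e_mem_fil FA j)))
        (smul_mem_fil_of_coord hy j hz)) (by
        simp [FilteredFree.e, hbx])
    rw [map_add, map_sub, map_smul, map_smul, map_sub, map_smul, hfx, smul_zero, sub_zero,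
      sub_add_cancel] at this
    exact this
  exact (hT.symm ▸ Set.mem_univ j : j ∈ {i | i ≠ j}) rfl

/-- A filtered endomorphism over `f` is an automorphism of filtered modules. -/
lemma bijective_of_comp_eq (hF : ∀ a ∈ FA 0, a ≠ 0 → ∃ b ∈ FA 0, b * a = 1)
    (hmin : IsMinimalOn FA L f) {θ : Module.End A (L.Carrier A)}
    (hθ : IsFiltered (L.fil FA) (L.fil FA) θ) (hfθ : ∀ x, f (θ x) = f x) :
    Function.Bijective θ ∧ ∀ q x, θ x ∈ L.fil FA q → x ∈ L.fil FA q := by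
  set ν : Module.End A (L.Carrier A) := θ - 1 with hν
  -- `ν (e_i)` is a relation in `F_{deg i} L`, so its coordinates have degree at most `deg i`, and
  -- minimality removes those of degree exactly `deg i`.
  have hνe : ∀ i k, ν (L.e A i) k ≠ 0 → L.deg k < L.deg i := by
    intro i k hk
    have hmem : ν (L.e A i) ∈ L.fil FA (L.deg i) :=
      sub_mem (hθ _ _ (L.e_mem_fil FA i)) (L.e_mem_fil FA i)
    have hle := ((FilteredFree.coord_of_mem_fil hmem k).resolve_left hk).1
    refine lt_of_le_of_ne hle fun h => hk ?_
    refine coord_eq_zero_of_isMinimalOn hF hmin (h ▸ hmem) ?_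
    show f (θ (L.e A i) - L.e A i) = 0
    rw [map_sub, hfθ, sub_self]
  have hpow : ∀ r x, (∀ i, x i ≠ 0 → L.deg i < r) → (ν ^ r) x = 0 := by
    intro r
    induction r with
    | zero =>
      intro x hx
      have : x = 0 := funext fun i => by
        by_contra h
        exact absurd (hx i h) (Nat.not_lt_zero _)
      rw [this, map_zero]
    | succ r ih =>
      intro x hx
      rw [pow_succ, Module.End.mul_apply]
      refine ih _ fun k hk => ?_
      rw [map_eq_sum, Finset.sum_apply] at hk
      obtain ⟨i, _, hi⟩ := Finset.exists_ne_zero_of_sum_ne_zero hk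
      have h1 : x i ≠ 0 := fun h => hi (by simp [h])
      have h2 : ν (L.e A i) k ≠ 0 := fun h => hi (by simp [h])
      have := hνe i k h2
      have := hx i h1
      omega
  obtain ⟨r, hr⟩ : ∃ r, ν ^ r = 0 := by
    -- Any bound strictly above all the degrees works as exponent.
    refine ⟨∑ i, L.deg i + 1, LinearMap.ext fun x => hpow _ x fun i _ => ?_⟩
    exact Nat.lt_succ_of_le
      (Finset.single_le_sum (f := L.deg) (fun _ _ => Nat.zero_le _) (Finset.mem_univ i))
  have hθν : θ = 1 + ν := by rw [hν]; abel
  refine ⟨?_, fun q x hx => ?_⟩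
  · have hu : IsUnit θ := by
      rw [hθν]
      exact IsNilpotent.isUnit_one_add ⟨r, hr⟩
    exact (Module.End.isUnit_iff _).1 hu
  · have hνfil : ∀ k y, y ∈ L.fil FA q → (ν ^ k) y ∈ L.fil FA q := by
      intro k
      induction k with
      | zero => exact fun y hy => hy
      | succ k ih =>
        intro y hy
        rw [pow_succ, Module.End.mul_apply]
        exact ih _ (sub_mem (hθ q y hy) hy)
    -- Descent from `ν ^ r = 0`: since `1 = θ - ν`, one has `ν ^ s x = ν ^ s (θ x) - ν ^ (s + 1) x`,
    -- and the first term is in `F_q` by hypothesis on `θ x`.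
    have hdown : ∀ k, (ν ^ (r - k)) x ∈ L.fil FA q := by
      intro k
      induction k with
      | zero => rw [Nat.sub_zero, hr]; exact zero_mem _
      | succ k ih =>
        rcases Nat.lt_or_ge k r with h | h
        · have e : (ν ^ (r - (k + 1))) x = (ν ^ (r - (k + 1))) (θ x) - (ν ^ (r - k)) x := by
            rw [show r - k = (r - (k + 1)) + 1 by omega, pow_succ, Module.End.mul_apply, ← map_sub]
            congr 1
            show x = θ x - (θ x - x)
            abel
          rw [e]
          exact sub_mem (hνfil _ _ hx) ih
        · rwa [Nat.sub_eq_zero_of_le (Nat.le_succ_of_le h), ← Nat.sub_eq_zero_of_le h]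
    have := hdown r
    rwa [Nat.sub_self] at this

/-- Strictness of `f'` lets the image of `e_j` be lifted within degree `deg j`; by freeness these
choices define a filtered map. -/
lemma exists_lift {f' : L'.Carrier A →ₗ[A] M} (hf' : IsStrictFiltered (L'.fil FA) FM f')
    {g : L.Carrier A →ₗ[A] M} (hg : IsFiltered (L.fil FA) FM g)
    (hr : ∀ x, g x ∈ Set.range f') :
    ∃ φ : L.Carrier A →ₗ[A] L'.Carrier A,
      IsFiltered (L.fil FA) (L'.fil FA) φ ∧ ∀ x, f' (φ x) = g x := by
  have h : ∀ j, ∃ z ∈ L'.fil FA (L.deg j), f' z = g (L.e A j) := fun j =>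
    (hf' (L.deg j)).superset ⟨hr _, hg _ _ (L.e_mem_fil FA j)⟩
  choose z hz hfz using h
  have he : ∀ j, Fintype.linearCombination A z (L.e A j) = z j := fun j => by
    rw [FilteredFree.e, Fintype.linearCombination_apply_single, one_smul]
  refine ⟨Fintype.linearCombination A z, isFiltered_of_map_e_mem fun j => ?_, fun x => ?_⟩
  · rw [he]; exact hz j
  · rw [map_eq_sum g, map_eq_sum (Fintype.linearCombination A z)]
    simp only [map_sum, map_smul, he, hfz]

/-- An isomorphism of filtered modules which matches the images of two minimal strict maps lifts
to the sources of these maps. -/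
lemma exists_filteredEquiv_lift (hF : ∀ a ∈ FA 0, a ≠ 0 → ∃ b ∈ FA 0, b * a = 1)
    {M' : Type*} [AddCommGroup M'] [Module K M'] [Module A M'] [IsScalarTower K A M']
    {FM' : ℕ → Submodule K M'} {f' : L'.Carrier A →ₗ[A] M'}
    (hf : IsStrictFiltered (L.fil FA) FM f) (hf' : IsStrictFiltered (L'.fil FA) FM' f')
    (hmin : IsMinimalOn FA L f) (hmin' : IsMinimalOn FA L' f') (χ : M ≃ₗ[A] M')
    (hχ : ∀ q x, χ x ∈ FM' q ↔ x ∈ FM q) (hr : ∀ x, χ x ∈ Set.range f' ↔ x ∈ Set.range f) :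
    ∃ ψ : L.Carrier A ≃ₗ[A] L'.Carrier A,
      (∀ q x, ψ x ∈ L'.fil FA q ↔ x ∈ L.fil FA q) ∧ ∀ x, f' (ψ x) = χ (f x) := by
  obtain ⟨φ, hφ, hfφ⟩ := exists_lift (L := L) hf' (g := χ.toLinearMap ∘ₗ f)
    (fun q x hx => (hχ q _).2 (hf.isFiltered q x hx)) (fun x => (hr _).2 ⟨x, rfl⟩)
  obtain ⟨ψ, hψ, hfψ⟩ := exists_lift (L := L') hf (g := χ.symm.toLinearMap ∘ₗ f')
    (fun q x hx => (hχ q _).1 (by simpa using hf'.isFiltered q x hx))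
    (fun x => (hr _).1 (by simp))
  obtain ⟨hb, hrefl⟩ := bijective_of_comp_eq hF hmin (θ := ψ ∘ₗ φ)
    (fun q x hx => hψ q _ (hφ q x hx)) (fun x => by simp [hfψ, hfφ])
  obtain ⟨hb', -⟩ := bijective_of_comp_eq hF hmin' (θ := φ ∘ₗ ψ)
    (fun q x hx => hφ q _ (hψ q x hx)) (fun x => by simp [hfψ, hfφ])
  -- Minimality of `f` gives injectivity through `ψ ∘ φ`, minimality of `f'` gives surjectivity
  -- through `φ ∘ ψ`.
  have hφb : Function.Bijective φ :=
    ⟨Function.Injective.of_comp (f := ψ) hb.1, Function.Surjective.of_comp (g := ψ) hb'.2⟩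
  exact ⟨LinearEquiv.ofBijective φ hφb,
    fun q x => ⟨fun h => hrefl q x (hψ q _ h), fun h => hφ q x h⟩, hfφ⟩

lemma isStrictFiltered_equiv {M' : Type*} [AddCommGroup M'] [Module K M'] [Module A M']
    {FM' : ℕ → Submodule K M'} (χ : M ≃ₗ[A] M') (hχ : ∀ q x, χ x ∈ FM' q ↔ x ∈ FM q) :
    IsStrictFiltered FM FM' (χ : M →ₗ[A] M') := by
  intro q
  ext y
  constructor
  · rintro ⟨x, hx, rfl⟩
    exact ⟨⟨x, rfl⟩, (hχ q x).2 hx⟩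
  · rintro ⟨⟨x, rfl⟩, hy⟩
    exact ⟨x, (hχ q x).1 hy, rfl⟩

end Lifting

/-! ### The three assertions for a minimal filtered free resolution. -/

section Resolution

variable {K : Type u} [Field K] {A : Type v} [Ring A] [Algebra K A]

/-- Since every `m i` is positive, `1` is the only monomial of degree `0`, so `F_0 A = K · 1`. -/
lemma FilteredSolvablePolynomialAlgebra.exists_inverse_of_mem_F_zero
    (S : FilteredSolvablePolynomialAlgebra K A) {a : A} (ha : a ∈ S.F 0) (hne : a ≠ 0) :
    ∃ b ∈ S.F 0, b * a = 1 := by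
  have hset : {α : Fin S.n → ℕ | ∑ i, S.m i * α i ≤ 0} = {0} := by
    ext α
    simp only [Set.mem_ofPred_eq, Nat.le_zero, Finset.sum_eq_zero_iff, Finset.mem_univ,
      true_implies, mul_eq_zero, Set.mem_singleton_iff, funext_iff, Pi.zero_apply]
    exact forall_congr' fun i => or_iff_right (S.m_pos i).ne'
  have hone : S.basis 0 = 1 := by
    rw [S.basis_eq]
    simp
  rw [FilteredSolvablePolynomialAlgebra.F, hset, Set.image_singleton, hone,
    Submodule.mem_span_singleton] at ha
  obtain ⟨c, rfl⟩ := ha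
  have hc : c ≠ 0 := fun h => hne (by rw [h, zero_smul])
  refine ⟨c⁻¹ • 1, Submodule.smul_mem _ _ IsAlgFiltration.one_mem, ?_⟩
  rw [smul_mul_smul_comm, inv_mul_cancel₀ hc, one_mul, one_smul]

namespace MinimalFilteredFreeResolution

variable {FA : ℕ → Submodule K A} {L₀ : FilteredFree} {N : Submodule A (L₀.Carrier A)}
  (R : MinimalFilteredFreeResolution FA L₀ N)

lemma image_mkQ (q : ℕ) :
    N.mkQ '' (L₀.fil FA q : Set (L₀.Carrier A)) = quotFil (L₀.fil FA) N q := rfl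

lemma isStrictFiltered_mkQ : IsStrictFiltered (L₀.fil FA) (quotFil (L₀.fil FA) N) N.mkQ := by
  intro q
  rw [image_mkQ, N.mkQ_surjective.range_eq, Set.univ_inter]

lemma isMinimalOn_mkQ (R : MinimalFilteredFreeResolution FA L₀ N) : IsMinimalOn FA L₀ N.mkQ :=
  isMinimalOn_of_isMinimalFBasis (fun q => image_mkQ q) R.minimal_aug

lemma isMinimalOn_d : ∀ i, IsMinimalOn FA (R.L (i + 1)) (R.d i)
  | 0 => isMinimalOn_of_isMinimalStandardBasis (R.strict 0) (fun y => R.exact_zero y)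
      R.minimal_zero
  | i + 1 =>
    isMinimalOn_of_isMinimalStandardBasis (R.strict (i + 1)) (fun y => R.exact_succ i y)
      (R.minimal_succ i)

variable [IsAlgFiltration FA]

lemma exact_grMap_mkQ {L : FilteredFree} {f : L.Carrier A →ₗ[A] L₀.Carrier A}
    (hf : IsStrictFiltered (L.fil FA) (L₀.fil FA) f) (h : Function.Exact f N.mkQ) :
    Function.Exact (grMap FA f hf.isFiltered) (grMap FA N.mkQ (isFiltered_mkQ FA L₀ N)) :=
  exact_grMap hf isStrictFiltered_mkQ h

lemma exact_reesMap_mkQ {L : FilteredFree} {f : L.Carrier A →ₗ[A] L₀.Carrier A}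
    (hf : IsStrictFiltered (L.fil FA) (L₀.fil FA) f) (h : Function.Exact f N.mkQ) :
    Function.Exact (reesMap FA f hf.isFiltered) (reesMap FA N.mkQ (isFiltered_mkQ FA L₀ N)) :=
  exact_reesMap hf _ h

theorem isMinimalGradedFreeResolution_gr :
    IsMinimalGradedFreeResolution (𝒜 := Gr FA) (X := fun i => Gr ((R.L i).fil FA))
      (Y := Gr (quotFil (L₀.fil FA) N)) (fun i => (R.L i).sigmaE FA)
      (fun i => grMap FA (R.d i) (R.strict i).isFiltered)
      (grMap FA N.mkQ (isFiltered_mkQ FA L₀ N)) where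
  finite _ := inferInstance
  homogeneous _ _ := ⟨_, _, rfl⟩
  linearIndependent i := linearIndependent_sigmaE (R.L i)
  span_eq_top i := span_sigmaE (R.L i)
  graded _ := isGradedHom_grMap _
  graded_aug := isGradedHom_grMap _
  surjective := surjective_grMap _ image_mkQ
  exact_zero := exact_grMap_mkQ (R.strict 0) R.exact_zero
  exact_succ i := exact_grMap (R.strict (i + 1)) (R.strict i) (R.exact_succ i)
  minimal_aug := isMinimalHomogeneousGenerating_sigmaE isStrictFiltered_mkQ R.isMinimalOn_mkQ
    (LinearMap.range_eq_top.2 (surjective_grMap _ image_mkQ))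
  minimal_zero := isMinimalHomogeneousGenerating_sigmaE (R.strict 0) (R.isMinimalOn_d 0)
    -- Exactness identifies the image, whose generators are known, with the kernel to be generated.
    (exact_grMap_mkQ (L₀ := L₀) (R.strict 0) R.exact_zero).linearMap_ker_eq.symm
  minimal_succ i := isMinimalHomogeneousGenerating_sigmaE (R.strict (i + 1))
    (R.isMinimalOn_d (i + 1))
    (exact_grMap (R.strict (i + 1)) (R.strict i) (R.exact_succ i)).linearMap_ker_eq.symm

theorem isMinimalGradedFreeResolution_rees :
    IsMinimalGradedFreeResolution (𝒜 := Rees FA) (X := fun i => Rees ((R.L i).fil FA))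
      (Y := Rees (quotFil (L₀.fil FA) N)) (fun i => (R.L i).tildeE FA)
      (fun i => reesMap FA (R.d i) (R.strict i).isFiltered)
      (reesMap FA N.mkQ (isFiltered_mkQ FA L₀ N)) where
  finite _ := inferInstance
  homogeneous _ _ := ⟨_, _, rfl⟩
  linearIndependent i := linearIndependent_tildeE (R.L i)
  span_eq_top i := span_tildeE (R.L i)
  graded _ := isGradedHom_reesMap _
  graded_aug := isGradedHom_reesMap _
  surjective := surjective_reesMap _ image_mkQ
  exact_zero := exact_reesMap_mkQ (R.strict 0) R.exact_zero
  exact_succ i := exact_reesMap (R.strict (i + 1)) _ (R.exact_succ i)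
  minimal_aug := isMinimalHomogeneousGenerating_tildeE _ R.isMinimalOn_mkQ
    (LinearMap.range_eq_top.2 (surjective_reesMap _ image_mkQ))
  minimal_zero := isMinimalHomogeneousGenerating_tildeE _ (R.isMinimalOn_d 0)
    (exact_reesMap_mkQ (L₀ := L₀) (R.strict 0) R.exact_zero).linearMap_ker_eq.symm
  minimal_succ i := isMinimalHomogeneousGenerating_tildeE _ (R.isMinimalOn_d (i + 1))
    (exact_reesMap (R.strict (i + 1)) _ (R.exact_succ i)).linearMap_ker_eq.symm

/-- The recursion carries, besides the filtered isomorphism in position `i`, the fact that it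
matches the images of the next differentials; this is what allows lifting once more. At the start
both images are the kernel of the same projection. -/
theorem exists_equiv (hF : ∀ a ∈ FA 0, a ≠ 0 → ∃ b ∈ FA 0, b * a = 1)
    (R' : MinimalFilteredFreeResolution FA L₀ N) :
    ∃ χ : ∀ i, (R.L i).Carrier A ≃ₗ[A] (R'.L i).Carrier A,
      χ 0 = LinearEquiv.refl A (L₀.Carrier A) ∧
      (∀ i, IsStrictFiltered ((R.L i).fil FA) ((R'.L i).fil FA)
        (χ i : (R.L i).Carrier A →ₗ[A] (R'.L i).Carrier A)) ∧
      ∀ i x, χ i (R.d i x) = R'.d i (χ (i + 1) x) := by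
  let State (i : ℕ) := {χ : (R.L i).Carrier A ≃ₗ[A] (R'.L i).Carrier A //
    (∀ q x, χ x ∈ (R'.L i).fil FA q ↔ x ∈ (R.L i).fil FA q) ∧
      ∀ x, χ x ∈ Set.range (R'.d i) ↔ x ∈ Set.range (R.d i)}
  have step : ∀ i (χ : State i), ∃ χ' : State (i + 1), ∀ x, χ.1 (R.d i x) = R'.d i (χ'.1 x) := by
    rintro i ⟨χ, hχ, hr⟩
    obtain ⟨ψ, hψ, hc⟩ := exists_filteredEquiv_lift hF (R.strict i) (R'.strict i)
      (R.isMinimalOn_d i) (R'.isMinimalOn_d i) χ hχ hr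
    refine ⟨⟨ψ, hψ, fun x => ?_⟩, fun x => (hc x).symm⟩
    -- By exactness the next images are the kernels of the current differentials, and these
    -- correspond because `χ` is injective and the square commutes.
    rw [← R'.exact_succ i, ← R.exact_succ i, hc, EmbeddingLike.map_eq_zero_iff]
  choose next hnext using step
  let start : State 0 := ⟨LinearEquiv.refl A _, fun q x => Iff.rfl, fun x =>
    (R'.exact_zero x).symm.trans (R.exact_zero x)⟩
  let χ : ∀ i, State i := fun i => Nat.rec start next i
  exact ⟨fun i => (χ i).1, rfl, fun i => isStrictFiltered_equiv _ (χ i).2.1,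
    fun i x => hnext i (χ i) x⟩

end MinimalFilteredFreeResolution

end Resolution

end SolvRes

theorem theorem5p6p3 {K : Type*} [Field K] {A : Type*} [Ring A] [Algebra K A]
    (S : SolvRes.FilteredSolvablePolynomialAlgebra K A)
    (L₀ : SolvRes.FilteredFree) (N : Submodule A (L₀.Carrier A))
    (R : SolvRes.MinimalFilteredFreeResolution S.F L₀ N) :
    -- the associated graded sequence is a minimal graded free resolution over `G(A)`
    SolvRes.IsMinimalGradedFreeResolution (𝒜 := SolvRes.Gr S.F)
      (X := fun i => SolvRes.Gr ((R.L i).fil S.F))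
      (Y := SolvRes.Gr (SolvRes.quotFil (L₀.fil S.F) N))
      (fun i => (R.L i).sigmaE S.F)
      (fun i => SolvRes.grMap S.F (R.d i) (R.strict i).isFiltered)
      (SolvRes.grMap S.F N.mkQ (SolvRes.isFiltered_mkQ S.F L₀ N)) ∧
    -- the sequence of Rees modules is a minimal graded free resolution over the Rees algebra
    SolvRes.IsMinimalGradedFreeResolution (𝒜 := SolvRes.Rees S.F)
      (X := fun i => SolvRes.Rees ((R.L i).fil S.F))
      (Y := SolvRes.Rees (SolvRes.quotFil (L₀.fil S.F) N))
      (fun i => (R.L i).tildeE S.F)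
      (fun i => SolvRes.reesMap S.F (R.d i) (R.strict i).isFiltered)
      (SolvRes.reesMap S.F N.mkQ (SolvRes.isFiltered_mkQ S.F L₀ N)) ∧
    -- uniqueness up to strict filtered isomorphism, identical on `L₀`
    ∀ R' : SolvRes.MinimalFilteredFreeResolution S.F L₀ N,
      ∃ χ : ∀ i, (R.L i).Carrier A ≃ₗ[A] (R'.L i).Carrier A,
        χ 0 = LinearEquiv.refl A (L₀.Carrier A) ∧
        (∀ i, SolvRes.IsStrictFiltered ((R.L i).fil S.F) ((R'.L i).fil S.F)
          (χ i : (R.L i).Carrier A →ₗ[A] (R'.L i).Carrier A)) ∧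
        ∀ i x, χ i (R.d i x) = R'.d i (χ (i + 1) x) := by
  exact ⟨R.isMinimalGradedFreeResolution_gr, R.isMinimalGradedFreeResolution_rees,
    R.exists_equiv fun _ ha hne => S.exists_inverse_of_mem_F_zero ha hne⟩
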